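/- Definitions. An $(r,s)$-formation is a concatenation of $s$ permutations of one set of $r$ distinct letters. $F_{r,s,k}(m)$ is the maximum number of distinct letters in a finite sequence that can be partitioned into $m$ contiguous (possibly empty) blocks of pairwise distinct letters, has no $(r,s)$-formation as a (not necessarily contiguous) subsequence, and contains each of its letters at least $k$ times. A $k$-chain on $[1,m]$ is a sequence of $k$ intervals $[a_0,a_1]\,[a_1+1,a_2]\cdots[a_{k-1}+1,a_k]$ of integers with $1\le a_0\le a_1<a_2<\dots<a_k\le m$; a set of $s$ distinct integers (an $s$-tuple) stabs it if its elements lie in pairwise different intervals of the chain. $\eta_{r,s,k}(m)$ is the maximum size of a collection of not necessarily distinct $k$-chains on $[1,m]$ in which no $r$ members are all stabbed by the same $s$-tuple. Let $A_1(n)=2n$ and, for $k\ge2$, $A_k(0)=1$ and $A_k(n)=A_{k-1}(A_k(n-1))$ for $n\ge1$; let $\alpha_k(x)=\min\{n: A_k(n)\ge x\}$. Corollary. For every $r\ge2$ and $d\ge 3$ and all $m \geq 0$ the following values are finite and $$F_{r,4,6}(m+1)=\eta_{r,3,5}(m),\qquad F_{r,4,2d+2}(m+1)=\eta_{r,3,2d+1}(m).$$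 As $m\to\infty$, both $F_{r,4,6}(m)$ and $\eta_{r,3,5}(m)$ are $\Omega(m\log\log m)$, and, for each $d\ge3$, both $F_{r,4,2d+2}(m)$ and $\eta_{r,3,2d+1}(m)$ are $\Omega\!\left(\frac1d\,m\,\alpha_d(m)\right)$. Explicitly: there are an absolute constant $c>0$ and an $N$ such that $F_{r,4,6}(m)\ge c\,m\log\log m$ and $\eta_{r,3,5}(m)\ge c\,m\log\log m$ for all $r\ge2$ and $m\ge N$; and there is an absolute constant $c>0$ such that for every $d\ge3$ there is an $N_d$ with $F_{r,4,2d+2}(m)\ge \frac{c}{d}\,m\,\alpha_d(m)$ and $\eta_{r,3,2d+1}(m)\ge \frac{c}{d}\,m\,\alpha_d(m)$ for all $r\ge2$ and $m\ge N_d$. -/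

import Mathlib

namespace FormationChains

/-! ### The Ackermann hierarchy -/

/-- `A_1(n) = 2n`, and for `k ≥ 2`: `A_k(0) = 1`, `A_k(n) = A_{k-1}(A_k(n-1))` for `n ≥ 1`.
The hierarchy starts at `k = 1`; the value at `k = 0` is a dummy that is never used. -/
def ackermannA : ℕ → ℕ → ℕ
  | 0, _ => 0
  | 1, n => 2 * n
  | _ + 2, 0 => 1
  | k + 2, n + 1 => ackermannA (k + 1) (ackermannA (k + 2) n)
termination_by k n => (k, n)

/-- `α_k(x) = min {n : A_k(n) ≥ x}`. -/
noncomputable def invAckermann (k x : ℕ) : ℕ :=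
  sInf {n : ℕ | x ≤ ackermannA k n}

/-! ### Formations -/

/-- `u` is an `(r, s)`-formation: a concatenation of `s` permutations of one set of
`r` distinct letters. -/
def IsFormation (r s : ℕ) (u : List ℕ) : Prop :=
  ∃ A : Finset ℕ, A.card = r ∧
    ∃ L : List (List ℕ), L.length = s ∧ (∀ l ∈ L, l.Nodup ∧ l.toFinset = A) ∧ u = L.flatten

/-- `w` avoids every `(r, s)`-formation: no (not necessarily contiguous) subsequence of `w`
is an `(r, s)`-formation. -/
def AvoidsFormations (r s : ℕ) (w : List ℕ) : Prop :=
  ∀ u : List ℕ, IsFormation r s u → ¬ u.Sublist w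

/-- `w` can be partitioned into `m` contiguous (possibly empty) blocks of pairwise distinct
letters. -/
def IsOnBlocks (m : ℕ) (w : List ℕ) : Prop :=
  ∃ B : List (List ℕ), B.length = m ∧ (∀ b ∈ B, b.Nodup) ∧ w = B.flatten

/-- `F_{r,s,k}(m)`: the maximum number of distinct letters in any sequence on `m` blocks which
avoids every `(r, s)`-formation and in which every letter occurs at least `k` times
(`⊤` if there is no maximum). -/
noncomputable def formationF (r s k m : ℕ) : ℕ∞ :=
  ⨆ w ∈ {w : List ℕ | IsOnBlocks m w ∧ AvoidsFormations r s w ∧ ∀ a ∈ w, k ≤ w.count a},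
    (w.toFinset.card : ℕ∞)

/-! ### Interval chains -/

/-- A `k`-chain on `[1, m]`: intervals `[a₀, a₁] [a₁ + 1, a₂] … [a_{k-1} + 1, a_k]` with
`1 ≤ a₀ ≤ a₁ < a₂ < … < a_k ≤ m`. -/
structure IntervalChain (k m : ℕ) where
  /-- the numbers `a₀, …, a_k` -/
  a : Fin (k + 1) → ℕ
  one_le : 1 ≤ a 0
  first_le : ∀ i : Fin k, i.val = 0 → a i.castSucc ≤ a i.succ
  lt_of_ne : ∀ i : Fin k, i.val ≠ 0 → a i.castSucc < a i.succ
  le_m : a (Fin.last k) ≤ m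

/-- The `i`-th interval (counted from `0`): `[a₀, a₁]` if `i = 0`,
and `[a_i + 1, a_{i+1}]` otherwise. -/
def IntervalChain.interval {k m : ℕ} (C : IntervalChain k m) (i : Fin k) : Finset ℕ :=
  Finset.Icc (if i.val = 0 then C.a i.castSucc else C.a i.castSucc + 1) (C.a i.succ)

/-- The tuple `T` (a finite set of numbers) stabs the chain `C`: its elements lie in pairwise
different intervals of `C`. -/
def IntervalChain.StabbedBy {k m : ℕ} (C : IntervalChain k m) (T : Finset ℕ) : Prop :=
  ∃ f : ℕ → Fin k, Set.InjOn f (T : Set ℕ) ∧ ∀ t ∈ T, t ∈ C.interval (f t)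

/-- A collection of `n` not necessarily distinct chains in which no `r` members are all stabbed
by the same `s`-tuple. -/
def NoCommonStab (r s : ℕ) {k m n : ℕ} (X : Fin n → IntervalChain k m) : Prop :=
  ¬ ∃ T : Finset ℕ, T.card = s ∧
    ∃ I : Finset (Fin n), I.card = r ∧ ∀ i ∈ I, (X i).StabbedBy T

/-- `η_{r,s,k}(m)`: the maximum size of a collection of not necessarily distinct `k`-chains on
`[1, m]` without `r` members that are all stabbed by the same `s`-tuple
(`⊤` if there is no maximum). -/
noncomputable def chainEta (r s k m : ℕ) : ℕ∞ :=
  ⨆ n ∈ {n : ℕ | ∃ X : Fin n → IntervalChain k m, NoCommonStab r s X}, (n : ℕ∞)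

end FormationChains

/-!
Only the sets of blocks in which the letters occur matter. A sequence on `m + 1` blocks contains an
`(r, s + 1)`-formation on given letters if their block sets split, along block boundaries, into
`s + 1` intervals each of which meets all the sets (`exists_formation_of_splitsInto`). The converse
holds if the letters of each block come in the order of decreasing previous occurrence
(`splitsInto_of_formation`). A `(k + 1)`-subset of `[0, m]` is in turn the same as a `k`-chain on
`[1, m]`, and cut points are the same as stabbing tuples (`noCommonStab_iff`). So both extremal
functions count families of sets of which no `r` split simultaneously (`HasSparseFamily`), which
gives the identities `formationF_succ_eq_chainEta`; finiteness is the pigeonhole principle.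

For the lower bounds it suffices to take `r = 2`, that is, to construct many sets of size `2 d + 2`
such that no two of them have four disjoint intervals which meet both (`FourMeet`). The construction
(`BlockSystem`) keeps track of pairs of adjacent blocks: the first two and the last two occurrences
of a letter lie in such pairs, and every pair carries the same number `j` of these. For `d = 1` the
letters are the points of a grid, each starting in one pair and ending in another. The system for
`d` and `j + 1` arises from the system for `d - 1`, by insertion of a copy of the system for `d`
and `j` into every pair (`BlockSystem.insert`): if the pairs carry as many letters as the copies have
pairs, then each letter moves its first and its last occurrence into a pair of its own in a copy,
and thus gains two occurrences. As an inserted segment contains at most two elements of each outer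
set, and as outer sets only change where they begin and end, no two sets acquire four common
intervals (`FourMeet.of_expand`, `not_fourMeet_expand_image`).

The number of blocks is at most three times the number of pairs (`exists_hasSystem`), so that `m`
blocks carry at least `m j / 12` letters. The recursion `numPairs` for the number of pairs gives a
double exponential function of `j` for `d = 2`, and for `d ≥ 3` a function below `A_d (3 j + C)`
(`exists_numPairs_le_ackermannA`). Inverting it yields the bounds; the constant does not depend on
`d`, even without the factor `1 / d`.
-/

namespace FormationChains

/-! ### Common splittings of a family of sets -/

/-- `SplitsInto 𝒜 t c`: the interval `[0, c)` contains `t` disjoint intervals, each of which meets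
every member of `𝒜`. -/
def SplitsInto (𝒜 : Set (Finset ℕ)) : ℕ → ℕ → Prop
  | 0, _ => True
  | t + 1, c => ∃ c' ≤ c, SplitsInto 𝒜 t c' ∧ ∀ X ∈ 𝒜, ∃ x ∈ X, c' ≤ x ∧ x < c

/-- There are `n` not necessarily distinct subsets of `[0, m)`, each with at least `k`
elements, such that no `r` of them
can be split simultaneously into `s` intervals. Both sequences on `m` blocks and interval chains
on `[1, m - 1]` are equivalent to such families. -/
def HasSparseFamily (r s k m n : ℕ) : Prop :=
  ∃ S : Fin n → Finset ℕ, (∀ i, S i ⊆ Finset.range m ∧ k ≤ (S i).card) ∧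
    ∀ I : Finset (Fin n), I.card = r → ∀ c, ¬ SplitsInto (S '' (I : Set (Fin n))) s c

theorem SplitsInto.anti {𝒜 𝒞 : Set (Finset ℕ)} (h : ∀ X ∈ 𝒞, ∃ Y ∈ 𝒜, Y ⊆ X) :
    ∀ {t c : ℕ}, SplitsInto 𝒜 t c → SplitsInto 𝒞 t c
  | 0, _, _ => trivial
  | t + 1, c, ⟨c', hc, h', hx⟩ => by
    refine ⟨c', hc, SplitsInto.anti h h', fun X hX => ?_⟩
    obtain ⟨Y, hY, hYX⟩ := h X hX
    obtain ⟨x, hxY, hx'⟩ := hx Y hY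
    exact ⟨x, hYX hxY, hx'⟩

theorem splitsInto_singleton (X : Finset ℕ) :
    ∀ (t c : ℕ), t ≤ (X.filter (· < c)).card → SplitsInto {X} t c
  | 0, _, _ => trivial
  | t + 1, c, h => by
    have hne : (X.filter (· < c)).Nonempty := by
      rw [← Finset.card_pos]; omega
    have hmem := Finset.max'_mem _ hne
    set x := (X.filter (· < c)).max' hne with hx
    rw [Finset.mem_filter] at hmem
    refine ⟨x, hmem.2.le, splitsInto_singleton X t x ?_, ?_⟩
    · have hsub : X.filter (· < c) ⊆ insert x (X.filter (· < x)) := by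
        intro y hy
        have hle : y ≤ x := Finset.le_max' _ _ hy
        rw [Finset.mem_filter] at hy
        rw [Finset.mem_insert, Finset.mem_filter]
        rcases hle.eq_or_lt with h | h
        · exact Or.inl h
        · exact Or.inr ⟨hy.1, h⟩
      have := (Finset.card_le_card hsub).trans (Finset.card_insert_le _ _)
      omega
    · rintro Y rfl
      exact ⟨x, hmem.1, le_rfl, hmem.2⟩

/-- A sparse family has bounded size: among more than `2 ^ m * r` subsets of `[0, m)`, at least `r`
coincide. -/
theorem HasSparseFamily.le {r s k m n : ℕ} (hsk : s ≤ k) (h : HasSparseFamily r s k m n) :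
    n ≤ 2 ^ m * r := by
  obtain ⟨S, hS, hI⟩ := h
  by_contra! hn
  obtain ⟨X, -, hX⟩ := Finset.exists_lt_card_fiber_of_mul_lt_card_of_maps_to
    (s := (Finset.univ : Finset (Fin n))) (t := (Finset.range m).powerset) (f := S) (n := r)
    (fun i _ => Finset.mem_powerset.2 (hS i).1) (by simpa using hn)
  obtain ⟨I, hIX, hIr⟩ := Finset.exists_subset_card_eq hX.le
  have hIX' : ∀ i ∈ I, S i = X := fun i hi => (Finset.mem_filter.1 (hIX hi)).2
  have hne : (Finset.univ.filter fun i => S i = X).Nonempty := Finset.card_pos.1 (by omega)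
  obtain ⟨i₀, hi₀⟩ := hne
  have hi₀ : S i₀ = X := (Finset.mem_filter.1 hi₀).2
  refine hI I hIr m (SplitsInto.anti (𝒜 := {X}) ?_ (splitsInto_singleton X s m ?_))
  · rintro _ ⟨i, hi, rfl⟩
    exact ⟨X, rfl, (hIX' i hi).ge⟩
  · rw [← hi₀, Finset.filter_true_of_mem fun x hx => Finset.mem_range.1 ((hS i₀).1 hx)]
    exact hsk.trans (hS i₀).2

theorem HasSparseFamily.mono {r r' s k m m' n : ℕ} (hr : r ≤ r') (hm : m ≤ m')
    (h : HasSparseFamily r s k m n) : HasSparseFamily r' s k m' n := by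
  obtain ⟨S, hS, hI⟩ := h
  refine ⟨S, fun i => ⟨(hS i).1.trans (Finset.range_mono hm), (hS i).2⟩, fun I hIr c hc => ?_⟩
  obtain ⟨J, hJI, hJ⟩ := Finset.exists_subset_card_eq (hr.trans hIr.ge)
  refine hI J hJ c (hc.anti ?_)
  rintro _ ⟨i, hi, rfl⟩
  exact ⟨_, ⟨i, hJI hi, rfl⟩, subset_rfl⟩

/-! ### Sequences and sparse families -/

/-- The set of indices of the blocks of `B` which contain the letter `a`. -/
def blocksOf (B : List (List ℕ)) (a : ℕ) : Finset ℕ :=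
  (Finset.range B.length).filter fun j => a ∈ B.getD j []

theorem count_flatten_eq_card (a : ℕ) :
    ∀ B : List (List ℕ), (∀ b ∈ B, b.Nodup) → B.flatten.count a = (blocksOf B a).card
  | [], _ => by simp [blocksOf]
  | b :: B, h => by
    have ih := count_flatten_eq_card a B fun x hx => h x (List.mem_cons_of_mem _ hx)
    have hb := h b List.mem_cons_self
    rw [blocksOf, Finset.card_filter] at ih ⊢
    rw [List.length_cons, Finset.sum_range_succ', List.flatten_cons, List.count_append, ih]
    simp only [List.getD_cons_succ, List.getD_cons_zero]
    rw [List.Nodup.count hb, add_comm]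

/-- If the occurrences of the letters `A` split into `t` intervals, then the first `c` blocks
contain a formation on `A` with `t` permutations. -/
theorem exists_formation_of_splitsInto (B : List (List ℕ)) (A : Finset ℕ) :
    ∀ t c : ℕ, SplitsInto (blocksOf B '' (A : Set ℕ)) t c →
      ∃ L : List (List ℕ), L.length = t ∧ (∀ l ∈ L, l.Nodup ∧ l.toFinset = A) ∧
        L.flatten.Sublist (B.take c).flatten
  | 0, _, _ => ⟨[], by simp⟩
  | t + 1, c, ⟨c', hc, h, hx⟩ => by
    obtain ⟨L, hL, hLA, hsub⟩ := exists_formation_of_splitsInto B A t c' h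
    set v := ((B.drop c').take (c - c')).flatten with hv
    refine ⟨L ++ [v.dedup.filter (· ∈ A)], by simp [hL], ?_, ?_⟩
    · intro l hl
      rw [List.mem_append, List.mem_singleton] at hl
      rcases hl with hl | rfl
      · exact hLA l hl
      · refine ⟨(List.nodup_dedup v).filter _, ?_⟩
        ext a
        simp only [List.mem_toFinset, List.mem_filter, List.mem_dedup, decide_eq_true_eq,
          and_iff_right_iff_imp]
        intro ha
        obtain ⟨x, hxa, h1, h2⟩ := hx _ ⟨a, ha, rfl⟩
        rw [blocksOf, Finset.mem_filter, Finset.mem_range] at hxa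
        rw [List.getD_eq_getElem _ _ hxa.1] at hxa
        rw [hv, List.mem_flatten]
        refine ⟨B[x], ?_, hxa.2⟩
        rw [List.mem_iff_getElem]
        refine ⟨x - c', by simp; omega, ?_⟩
        simp [Nat.add_sub_cancel' h1]
    · have : B.take c = B.take c' ++ (B.drop c').take (c - c') := by
        rw [← List.take_add, Nat.add_sub_cancel' hc]
      rw [this, List.flatten_append, List.flatten_append]
      refine hsub.append ?_
      simpa using List.filter_sublist.trans (List.dedup_sublist v)

theorem hasSparseFamily_of_word {r s k m : ℕ} {w : List ℕ} (hw : IsOnBlocks m w)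
    (ha : AvoidsFormations r s w) (hk : ∀ a ∈ w, k ≤ w.count a) :
    HasSparseFamily r s k m w.toFinset.card := by
  obtain ⟨B, hB, hnd, rfl⟩ := hw
  let e := B.flatten.toFinset.equivFin.symm
  refine ⟨fun i => blocksOf B (e i), fun i => ⟨?_, ?_⟩, fun I hI c hc => ?_⟩
  · rw [← hB]
    exact Finset.filter_subset _ _
  · rw [← count_flatten_eq_card _ B hnd]
    exact hk _ (List.mem_toFinset.1 (e i).2)
  · have hinj : Function.Injective fun i => (e i : ℕ) :=
      Subtype.val_injective.comp e.injective
    have himg : (fun i => blocksOf B (e i)) '' (I : Set _) =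
        blocksOf B '' ((I.image fun i => (e i : ℕ) : Finset ℕ) : Set ℕ) := by
      rw [Finset.coe_image, Set.image_image]
    rw [himg] at hc
    obtain ⟨L, hL, hLA, hsub⟩ := exists_formation_of_splitsInto B _ s c hc
    exact ha _ ⟨_, (Finset.card_image_of_injective I hinj).trans hI, L, hL, hLA, rfl⟩
      (hsub.trans (List.take_sublist c B).flatten)

/-- The relation between an earlier entry `(a, i)` and a later entry `(b, j)` of a sequence whose
letters are tagged with their block, where the letters of a block come in the order of decreasing
previous occurrence. -/
def TagOrder (key : ℕ → ℕ → ℕ) (p q : ℕ × ℕ) : Prop :=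
  p.2 < q.2 ∨ p.2 = q.2 ∧ p.1 ≠ q.1 ∧ key q.2 q.1 ≤ key p.2 p.1

/-- One more than the last element of `S a` below `j`, and `0` if there is none. -/
def prevKey (S : ℕ → Finset ℕ) (j a : ℕ) : ℕ :=
  ((S a).filter (· < j)).sup (· + 1)

/-- The greedy argument: if the letters of each block come in the order of decreasing previous
occurrence, then a formation in the sequence yields a splitting along block boundaries. The cuts
are chosen as early as possible, and then every letter of `A` occurring after the first `t`
permutations also occurs after the `t`-th cut. -/
theorem splitsInto_of_formation {S : ℕ → Finset ℕ} {A : Finset ℕ} {W : List (ℕ × ℕ)}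
    (hW : W.Pairwise (TagOrder (prevKey S))) (hS : ∀ p ∈ W, p.2 ∈ S p.1) :
    ∀ (t : ℕ) (L : List (List ℕ)) (p q : List (ℕ × ℕ)), W = p ++ q → L.length = t →
      (∀ l ∈ L, l.toFinset = A) → L.flatten.Sublist (p.map Prod.fst) →
      ∃ c, SplitsInto (S '' (A : Set ℕ)) t c ∧ ∀ x ∈ q, x.1 ∈ A → c ≤ x.2
  | 0, _, _, _, _, _, _, _ => ⟨0, trivial, fun _ _ _ => Nat.zero_le _⟩
  | t + 1, L, p, q, hWpq, hL, hLA, hsub => by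
    classical
    obtain ⟨L', l, rfl⟩ : ∃ L' l, L = L' ++ [l] := by
      have hne : L ≠ [] := by rintro rfl; simp at hL
      exact ⟨L.dropLast, L.getLast hne, (List.dropLast_append_getLast hne).symm⟩
    rw [List.flatten_append, List.append_sublist_iff] at hsub
    obtain ⟨w₁, w₂, hw, h₁, h₂⟩ := hsub
    obtain ⟨p₁, p₂, rfl, rfl, rfl⟩ := List.map_eq_append_iff.1 hw
    obtain ⟨c, hc, hcq⟩ := splitsInto_of_formation hW hS t L' p₁ (p₂ ++ q)
      (by rw [hWpq, List.append_assoc]) (by simpa using hL)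
      (fun l hl => hLA l (List.mem_append_left _ hl)) h₁
    have hl : l.toFinset = A := hLA l (by simp)
    have hocc : ∀ a ∈ A, ∃ i, (a, i) ∈ p₂ := by
      intro a ha
      rw [← hl, List.mem_toFinset] at ha
      have := h₂.subset (by simpa using ha : a ∈ [l].flatten)
      simpa using this
    have hmemW : ∀ x ∈ p₂, x ∈ W := fun x hx => by rw [hWpq]; simp [hx]
    have hex : ∃ c', c ≤ c' ∧ ∀ a ∈ A, ∃ x ∈ S a, c ≤ x ∧ x < c' := by
      refine ⟨c + (p₂.map Prod.snd).sum + 1, by omega, fun a ha => ?_⟩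
      obtain ⟨i, hi⟩ := hocc a ha
      refine ⟨i, hS _ (hmemW _ hi), hcq _ (List.mem_append_left _ hi) ha, ?_⟩
      have : i ≤ (p₂.map Prod.snd).sum :=
        List.le_sum_of_mem (List.mem_map.2 ⟨_, hi, rfl⟩)
      omega
    obtain ⟨hcc, hspec⟩ := Nat.find_spec hex
    refine ⟨Nat.find hex, ⟨c, hcc, hc, ?_⟩, ?_⟩
    · rintro _ ⟨a, ha, rfl⟩
      exact hspec a ha
    · rintro ⟨y, j⟩ hyq hyA
      by_contra! hj
      -- some letter `x` has no occurrence in the blocks from `c` to `j - 1`, as the cut is minimal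
      have hmin := Nat.find_min hex hj
      have hcj : c ≤ j := hcq _ (List.mem_append_right _ hyq) hyA
      push Not at hmin
      obtain ⟨x, hxA, hx⟩ := hmin hcj
      have hpw : ∀ u ∈ p₂, TagOrder (prevKey S) u (y, j) := by
        rw [hWpq] at hW
        exact fun u hu => (List.pairwise_append.1 hW).2.2 u (List.mem_append_right _ hu) _ hyq
      obtain ⟨i, hi⟩ := hocc x hxA
      obtain ⟨i', hi'⟩ := hocc y hyA
      have hxi := hx i (hS _ (hmemW _ hi)) (hcq _ (List.mem_append_left _ hi) hxA)
      have hci' := hcq _ (List.mem_append_left _ hi') hyA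
      have hyi' := hS _ (hmemW _ hi')
      have hi'j : i' < j := by
        rcases hpw _ hi' with h | h
        · exact h
        · exact absurd rfl h.2.1
      rcases hpw _ hi with h | ⟨rfl, -, hkey⟩
      · exact absurd h (not_lt.2 hxi)
      · -- the previous occurrence of `y` is at least `c`, that of `x` is smaller
        have h1 : i' + 1 ≤ prevKey S i y :=
          Finset.le_sup (f := (· + 1)) (Finset.mem_filter.2 ⟨hyi', hi'j⟩)
        have h2 : prevKey S i x ≤ c := by
          refine Finset.sup_le fun z hz => ?_
          rw [Finset.mem_filter] at hz
          by_contra! hlt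
          exact absurd hz.2 (not_lt.2 (hx z hz.1 (by omega)))
        have hci' : c ≤ i' := hci'
        have hkey : prevKey S i y ≤ prevKey S i x := hkey
        omega

theorem exists_list_sorted_by (F : Finset ℕ) (key : ℕ → ℕ) :
    ∃ l : List ℕ, l.Nodup ∧ (∀ a, a ∈ l ↔ a ∈ F) ∧ l.Pairwise fun a b => key b ≤ key a := by
  let R : ℕ → ℕ → Prop := fun a b => key b ≤ key a
  have : Std.Total R := ⟨fun a b => le_total (key b) (key a)⟩
  have : IsTrans ℕ R := ⟨fun a b c hab hbc => le_trans hbc hab⟩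
  refine ⟨F.toList.insertionSort R, ?_, fun a => ?_, List.pairwise_insertionSort R _⟩
  · exact (List.perm_insertionSort R _).nodup_iff.2 F.nodup_toList
  · rw [(List.perm_insertionSort R _).mem_iff, Finset.mem_toList]

theorem exists_word_of_hasSparseFamily {r s k m n : ℕ} (hk : 1 ≤ k) (hs : 1 ≤ s)
    (h : HasSparseFamily r s k m n) :
    ∃ w : List ℕ, IsOnBlocks m w ∧ AvoidsFormations r s w ∧ (∀ a ∈ w, k ≤ w.count a) ∧
      w.toFinset.card = n := by
  obtain ⟨S, hS, hI⟩ := h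
  let T : ℕ → Finset ℕ := fun a => if h : a < n then S ⟨a, h⟩ else ∅
  have hT : ∀ i : Fin n, T i = S i := fun i => dif_pos i.2
  choose blk hnd hmem hsort using fun j =>
    exists_list_sorted_by ((Finset.range n).filter fun a => j ∈ T a) (prevKey T j)
  have hmem' : ∀ j a, a ∈ blk j ↔ a < n ∧ j ∈ T a := fun j a => by simp [hmem]
  have hTm : ∀ a, T a ⊆ Finset.range m := fun a => by
    by_cases ha : a < n
    · exact (hT ⟨a, ha⟩).le.trans (hS _).1
    · simp [T, ha]
  set B : List (List ℕ) := (List.range m).map blk with hB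
  have hBnd : ∀ b ∈ B, b.Nodup := by
    intro b hb
    obtain ⟨j, -, rfl⟩ := List.mem_map.1 hb
    exact hnd j
  have hocc : ∀ a < n, blocksOf B a = T a := by
    intro a ha
    ext j
    simp only [blocksOf, hB, Finset.mem_filter, Finset.mem_range, List.length_map,
      List.length_range]
    constructor
    · rintro ⟨hj, h⟩
      rw [List.getD_eq_getElem _ _ (by simpa using hj)] at h
      simp only [List.getElem_map, List.getElem_range] at h
      exact ((hmem' j a).1 h).2
    · intro h
      have hj := Finset.mem_range.1 (hTm a h)
      refine ⟨hj, ?_⟩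
      rw [List.getD_eq_getElem _ _ (by simpa using hj)]
      simp only [List.getElem_map, List.getElem_range]
      exact (hmem' j a).2 ⟨ha, h⟩
  have hltn : ∀ a ∈ B.flatten, a < n := by
    intro a ha
    obtain ⟨b, hb, hab⟩ := List.mem_flatten.1 ha
    obtain ⟨j, -, rfl⟩ := List.mem_map.1 hb
    exact ((hmem' j a).1 hab).1
  have hcount : ∀ a < n, k ≤ B.flatten.count a := by
    intro a ha
    rw [count_flatten_eq_card a B hBnd, hocc a ha, hT ⟨a, ha⟩]
    exact (hS _).2
  refine ⟨B.flatten, ⟨B, by simp [hB], hBnd, rfl⟩, ?_, fun a ha => hcount a (hltn a ha), ?_⟩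
  · rintro u ⟨A, hA, L, hL, hLA, rfl⟩ hsub
    set W : List (ℕ × ℕ) := (List.range m).flatMap fun j => (blk j).map fun a => (a, j) with hW
    have hWB : W.map Prod.fst = B.flatten := by
      rw [hW, List.map_flatMap, hB, ← List.flatMap_def]
      simp [Function.comp_def]
    have hWmem : ∀ p ∈ W, p.2 ∈ T p.1 := by
      rintro ⟨a, j⟩ hp
      simp only [hW, List.mem_flatMap, List.mem_map, Prod.mk.injEq] at hp
      obtain ⟨j', -, a', ha', rfl, rfl⟩ := hp
      exact ((hmem' _ _).1 ha').2
    have hWpw : W.Pairwise (TagOrder (prevKey T)) := by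
      rw [hW, List.pairwise_flatMap]
      constructor
      · intro j _
        rw [List.pairwise_map]
        exact ((hnd j).and (hsort j)).imp fun h => Or.inr ⟨rfl, h.1, h.2⟩
      · refine List.pairwise_lt_range.imp fun {i j} hij => ?_
        intro x hx y hy
        simp only [List.mem_map] at hx hy
        obtain ⟨_, -, rfl⟩ := hx
        obtain ⟨_, -, rfl⟩ := hy
        exact Or.inl hij
    obtain ⟨c, hc, -⟩ := splitsInto_of_formation hWpw hWmem s L W [] (by simp) hL
      (fun l hl => (hLA l hl).2) (hWB ▸ hsub)
    have hAn : ∀ a ∈ A, a < n := by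
      intro a ha
      obtain ⟨l, hl⟩ := List.exists_mem_of_length_pos (hL ▸ hs : 0 < L.length)
      refine hltn a (hsub.subset (List.mem_flatten.2 ⟨l, hl, ?_⟩))
      rw [← List.mem_toFinset, (hLA l hl).2]
      exact ha
    refine hI (A.attachFin hAn) (by simpa using hA) c (hc.anti ?_)
    rintro _ ⟨i, hi, rfl⟩
    exact ⟨T i, ⟨i, by simpa using hi, rfl⟩, (hT i).le⟩
  · have : B.flatten.toFinset = Finset.range n := by
      ext a
      rw [List.mem_toFinset, Finset.mem_range]
      exact ⟨hltn a, fun ha => List.count_pos_iff.1 (hk.trans (hcount a ha))⟩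
    rw [this, Finset.card_range]

theorem formationF_eq {r s k : ℕ} (hk : 1 ≤ k) (hs : 1 ≤ s) (m : ℕ) :
    formationF r s k m = ⨆ n ∈ {n : ℕ | HasSparseFamily r s k m n}, (n : ℕ∞) := by
  apply le_antisymm
  · refine iSup₂_le fun w hw => ?_
    exact le_iSup₂_of_le (f := fun (n : ℕ) _ => (n : ℕ∞)) w.toFinset.card
      (hasSparseFamily_of_word hw.1 hw.2.1 hw.2.2) le_rfl
  · refine iSup₂_le fun n hn => ?_
    obtain ⟨w, h1, h2, h3, rfl⟩ := exists_word_of_hasSparseFamily hk hs hn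
    exact le_iSup₂_of_le (f := fun (w : List ℕ) _ => (w.toFinset.card : ℕ∞)) w ⟨h1, h2, h3⟩ le_rfl

/-! ### Interval chains and sparse families -/

/-- The number of elements of `X` below `c`. -/
def countBelow (X : Finset ℕ) (c : ℕ) : ℕ := (X.filter (· < c)).card

theorem countBelow_mono (X : Finset ℕ) : Monotone (countBelow X) := fun _ _ h =>
  Finset.card_le_card (Finset.monotone_filter_right _ fun _ _ hx => lt_of_lt_of_le hx h)

theorem countBelow_le_card (X : Finset ℕ) (c : ℕ) : countBelow X c ≤ X.card :=
  Finset.card_le_card (Finset.filter_subset _ _)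

theorem countBelow_lt_iff {X : Finset ℕ} {c c' : ℕ} (h : c ≤ c') :
    countBelow X c < countBelow X c' ↔ ∃ x ∈ X, c ≤ x ∧ x < c' := by
  constructor
  · intro hlt
    by_contra! hno
    refine absurd (Finset.card_le_card ?_) (not_le.2 hlt)
    intro x hx
    rw [Finset.mem_filter] at hx ⊢
    refine ⟨hx.1, ?_⟩
    by_contra! hcx
    exact absurd hx.2 (not_lt.2 (hno x hx.1 hcx))
  · rintro ⟨x, hx, h1, h2⟩
    refine Finset.card_lt_card ⟨Finset.monotone_filter_right _ fun _ _ hx => hx.trans_le h, ?_⟩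
    intro hsub
    have := hsub (Finset.mem_filter.2 ⟨hx, h2⟩)
    rw [Finset.mem_filter] at this
    omega

/-- The cut points of a splitting into `t + 1` intervals separate the elements of every set. -/
theorem exists_separating_of_splitsInto {𝒜 : Set (Finset ℕ)} (hne : 𝒜.Nonempty) :
    ∀ t c : ℕ, SplitsInto 𝒜 (t + 1) c →
      (∀ X ∈ 𝒜, 1 ≤ countBelow X c) ∧ ∃ T : Finset ℕ, T.card = t ∧ ∀ X ∈ 𝒜,
        Set.InjOn (countBelow X) T ∧ ∀ τ ∈ T, 1 ≤ countBelow X τ ∧ countBelow X τ < countBelow X c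
  | 0, c, ⟨c', hc, _, hx⟩ => by
    refine ⟨fun X hX => ?_, ∅, rfl, by simp⟩
    exact Nat.one_le_iff_ne_zero.2 (Nat.ne_zero_of_lt ((countBelow_lt_iff hc).2 (hx X hX)))
  | t + 1, c, ⟨c', hc, h, hx⟩ => by
    obtain ⟨h1, T, hT, hTX⟩ := exists_separating_of_splitsInto hne t c' h
    have hlt : ∀ X ∈ 𝒜, countBelow X c' < countBelow X c := fun X hX =>
      (countBelow_lt_iff hc).2 (hx X hX)
    refine ⟨fun X hX => (h1 X hX).trans (hlt X hX).le, insert c' T, ?_, fun X hX => ?_⟩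
    · rw [Finset.card_insert_of_notMem, hT]
      intro hcT
      obtain ⟨X, hX⟩ := hne
      exact lt_irrefl _ ((hTX X hX).2 c' hcT).2
    · constructor
      · rw [Finset.coe_insert, Set.injOn_insert]
        · refine ⟨(hTX X hX).1, ?_⟩
          rintro ⟨τ, hτ, he⟩
          exact absurd he ((hTX X hX).2 τ hτ).2.ne
        · intro hcT
          exact lt_irrefl _ ((hTX X hX).2 c' hcT).2
      · intro τ hτ
        rcases Finset.mem_insert.1 hτ with rfl | hτ
        · exact ⟨h1 X hX, hlt X hX⟩
        · exact ⟨((hTX X hX).2 τ hτ).1, ((hTX X hX).2 τ hτ).2.trans (hlt X hX)⟩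

theorem splitsInto_of_separating {𝒜 : Set (Finset ℕ)} (hne : 𝒜.Nonempty) :
    ∀ (t : ℕ) (T : Finset ℕ) (c : ℕ), T.card = t → (∀ X ∈ 𝒜, 1 ≤ countBelow X c ∧
        Set.InjOn (countBelow X) T ∧
        ∀ τ ∈ T, 1 ≤ countBelow X τ ∧ countBelow X τ < countBelow X c) →
      SplitsInto 𝒜 (t + 1) c
  | 0, _, c, _, h => ⟨0, Nat.zero_le _, trivial, fun X hX =>
      (countBelow_lt_iff (Nat.zero_le c)).1 (by
        have := (h X hX).1
        have h0 : countBelow X 0 = 0 := by simp [countBelow]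
        omega)⟩
  | t + 1, T, c, hT, h => by
    have hTne : T.Nonempty := Finset.card_pos.1 (by omega)
    set τ := T.max' hTne
    have hτ : τ ∈ T := T.max'_mem hTne
    obtain ⟨X₀, hX₀⟩ := hne
    have hτc : τ ≤ c := by
      by_contra! hlt
      exact absurd (countBelow_mono X₀ hlt.le) (not_le.2 ((h X₀ hX₀).2.2 τ hτ).2)
    refine ⟨τ, hτc, splitsInto_of_separating ⟨X₀, hX₀⟩ t (T.erase τ) τ ?_ ?_, ?_⟩
    · rw [Finset.card_erase_of_mem hτ, hT, Nat.add_sub_cancel]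
    · intro X hX
      obtain ⟨-, hinj, hτX⟩ := h X hX
      refine ⟨(hτX τ hτ).1, hinj.mono (Finset.coe_subset.2 (Finset.erase_subset _ _)), ?_⟩
      intro σ hσ
      have hσT := Finset.mem_of_mem_erase hσ
      refine ⟨(hτX σ hσT).1, lt_of_le_of_ne (countBelow_mono X (T.le_max' σ hσT)) ?_⟩
      exact fun he => Finset.ne_of_mem_erase hσ (hinj hσT hτ he)
    · intro X hX
      exact (countBelow_lt_iff hτc).1 ((h X hX).2.2 τ hτ).2

namespace IntervalChain

variable {k m : ℕ}

/-- The left end points of the intervals of a chain, shifted to the left by one, followed by the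
right end point of the chain. A number `t` lies in the `i`-th interval if it is larger than the
first `i + 1` of these points and not larger than the others. -/
def point (C : IntervalChain k m) (i : Fin (k + 1)) : ℕ :=
  if i.val = 0 then C.a i - 1 else C.a i

theorem point_strictMono (C : IntervalChain k m) : StrictMono C.point := by
  rw [Fin.strictMono_iff_lt_succ]
  intro i
  have h0 := C.one_le
  by_cases hi : i.val = 0
  · have h1 := C.first_le i hi
    have hi' : i.castSucc = 0 := Fin.ext hi
    rw [hi'] at h1
    simp only [point, Fin.val_castSucc, hi, Fin.val_succ, if_true]
    rw [hi', if_neg (by omega)]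
    omega
  · have h1 := C.lt_of_ne i hi
    simp only [point, Fin.val_castSucc, hi, Fin.val_succ, if_false]
    rwa [if_neg (by omega)]

theorem point_le (C : IntervalChain k m) (i : Fin (k + 1)) : C.point i ≤ m := by
  refine (C.point_strictMono.monotone (Fin.le_last i)).trans (le_trans ?_ C.le_m)
  rw [point]
  split_ifs <;> omega

/-- The set of points of a chain. -/
def points (C : IntervalChain k m) : Finset ℕ := Finset.univ.image C.point

theorem card_points (C : IntervalChain k m) : C.points.card = k + 1 := by
  rw [points, Finset.card_image_of_injective _ C.point_strictMono.injective, Finset.card_fin]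

theorem mem_interval_iff (C : IntervalChain k m) (i : Fin k) (t : ℕ) :
    t ∈ C.interval i ↔ C.point i.castSucc < t ∧ t ≤ C.point i.succ := by
  have h0 := C.one_le
  rw [interval, Finset.mem_Icc, point, point]
  simp only [Fin.val_castSucc, Fin.val_succ]
  rw [if_neg (by omega : ¬ (i : ℕ) + 1 = 0)]
  by_cases hi : i.val = 0
  · have hi' : i.castSucc = 0 := Fin.ext hi
    rw [if_pos hi, if_pos hi, hi']
    omega
  · rw [if_neg hi, if_neg hi]
    omega

theorem mem_interval_iff_countBelow (C : IntervalChain k m) (i : Fin k) (t : ℕ) :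
    t ∈ C.interval i ↔ countBelow C.points t = i + 1 := by
  have hcard : ∀ t, countBelow C.points t = (Finset.univ.filter fun j => C.point j < t).card := by
    intro t
    rw [countBelow, points, Finset.filter_image,
      Finset.card_image_of_injective _ C.point_strictMono.injective]
  have key : ∀ j : Fin (k + 1), C.point j < t ↔ (j : ℕ) < countBelow C.points t := by
    intro j
    rw [hcard]
    constructor
    · intro h
      have : Finset.Iic j ⊆ Finset.univ.filter fun j => C.point j < t := fun l hl =>
        Finset.mem_filter.2 ⟨Finset.mem_univ _,
          (C.point_strictMono.monotone (Finset.mem_Iic.1 hl)).trans_lt h⟩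
      have := Finset.card_le_card this
      rw [Fin.card_Iic] at this
      omega
    · intro h
      by_contra! hle
      have : (Finset.univ.filter fun j => C.point j < t) ⊆ Finset.Iio j := fun l hl => by
        rw [Finset.mem_Iio]
        exact C.point_strictMono.lt_iff_lt.1 ((Finset.mem_filter.1 hl).2.trans_le hle)
      have := Finset.card_le_card this
      rw [Fin.card_Iio] at this
      omega
  rw [mem_interval_iff, ← not_lt (a := C.point i.succ), key, key]
  simp only [Fin.val_castSucc, Fin.val_succ]
  omega

theorem stabbedBy_iff (C : IntervalChain k m) (T : Finset ℕ) (hT : T.Nonempty) :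
    C.StabbedBy T ↔ Set.InjOn (countBelow C.points) T ∧
      ∀ t ∈ T, 1 ≤ countBelow C.points t ∧ countBelow C.points t < k + 1 := by
  constructor
  · rintro ⟨f, hf, hfT⟩
    have hft : ∀ t ∈ T, countBelow C.points t = f t + 1 := fun t ht =>
      (C.mem_interval_iff_countBelow _ _).1 (hfT t ht)
    refine ⟨fun t ht u hu h => hf ht hu ?_, fun t ht => ?_⟩
    · change countBelow C.points t = countBelow C.points u at h
      rw [hft t ht, hft u hu] at h
      exact Fin.ext (by omega)
    · rw [hft t ht]
      have := (f t).2
      omega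
  · rintro ⟨hinj, hT'⟩
    obtain ⟨t₀, ht₀⟩ := hT
    have := hT' t₀ ht₀
    refine ⟨fun t => if h : countBelow C.points t - 1 < k then ⟨_, h⟩ else ⟨0, by omega⟩, ?_, ?_⟩
    · intro t ht u hu h
      have h1 := hT' t ht
      have h2 := hT' u hu
      simp only [dif_pos (show countBelow C.points t - 1 < k by omega),
        dif_pos (show countBelow C.points u - 1 < k by omega), Fin.mk.injEq] at h
      exact hinj ht hu (by omega)
    · intro t ht
      have h1 := hT' t ht
      rw [C.mem_interval_iff_countBelow]
      simp only [dif_pos (show countBelow C.points t - 1 < k by omega)]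
      omega

/-- Every set of `k + 1` numbers in `[0, m]` is the set of points of a chain. -/
theorem exists_points_eq (hk : 1 ≤ k) (X : Finset ℕ) (hX : X ⊆ Finset.range (m + 1))
    (hc : X.card = k + 1) : ∃ C : IntervalChain k m, C.points = X := by
  let b := X.orderEmbOfFin hc
  have hb : StrictMono b := (X.orderEmbOfFin hc).strictMono
  have hbm : ∀ i, b i ≤ m := fun i =>
    Nat.lt_succ_iff.1 (Finset.mem_range.1 (hX (X.orderEmbOfFin_mem hc i)))
  let C : IntervalChain k m :=
    { a := fun i => if i.val = 0 then b i + 1 else b i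
      one_le := by simp
      first_le := fun i hi => by
        have := hb i.castSucc_lt_succ
        simp only [Fin.val_castSucc, hi, if_true, Fin.val_succ]
        rw [if_neg (by omega)]
        omega
      lt_of_ne := fun i hi => by
        have := hb i.castSucc_lt_succ
        simp only [Fin.val_castSucc, hi, if_false, Fin.val_succ]
        rwa [if_neg (by omega)]
      le_m := by
        rw [Fin.val_last, if_neg (by omega)]
        exact hbm _ }
  refine ⟨C, ?_⟩
  have hp : C.point = b := by
    funext i
    simp only [point, C]
    split_ifs <;> simp
  rw [points, hp]
  apply Finset.coe_injective
  rw [Finset.coe_image, Finset.coe_univ, Set.image_univ]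
  exact X.range_orderEmbOfFin hc

end IntervalChain

theorem noCommonStab_iff {r s k m n : ℕ} (hr : 1 ≤ r) (hs : 1 ≤ s)
    (X : Fin n → IntervalChain k m) : NoCommonStab r s X ↔
      ∀ I : Finset (Fin n), I.card = r → ∀ c,
        ¬ SplitsInto ((fun i => (X i).points) '' (I : Set (Fin n))) (s + 1) c := by
  constructor
  · intro h I hI c hc
    have hne : ((fun i => (X i).points) '' (I : Set (Fin n))).Nonempty :=
      (Finset.coe_nonempty.2 (Finset.card_pos.1 (by omega))).image _
    obtain ⟨-, T, hT, hTX⟩ := exists_separating_of_splitsInto hne s c hc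
    refine h ⟨T, hT, I, hI, fun i hi => ?_⟩
    rw [IntervalChain.stabbedBy_iff _ _ (Finset.card_pos.1 (by omega))]
    obtain ⟨h1, h2⟩ := hTX _ ⟨i, hi, rfl⟩
    exact ⟨h1, fun t ht => ⟨(h2 t ht).1, (h2 t ht).2.trans_le
      ((countBelow_le_card _ _).trans (X i).card_points.le)⟩⟩
  · rintro h ⟨T, hT, I, hI, hst⟩
    have hne : ((fun i => (X i).points) '' (I : Set (Fin n))).Nonempty :=
      (Finset.coe_nonempty.2 (Finset.card_pos.1 (by omega))).image _
    refine h I hI (m + 1) (splitsInto_of_separating hne s T _ hT ?_)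
    rintro _ ⟨i, hi, rfl⟩
    have hfull : countBelow (X i).points (m + 1) = k + 1 := by
      rw [countBelow, Finset.filter_true_of_mem, (X i).card_points]
      intro x hx
      obtain ⟨j, -, rfl⟩ := Finset.mem_image.1 hx
      exact Nat.lt_succ_of_le ((X i).point_le j)
    have := ((X i).stabbedBy_iff T (Finset.card_pos.1 (by omega))).1 (hst i hi)
    simp only [hfull]
    exact ⟨by omega, this⟩

theorem chainEta_eq {r s k : ℕ} (hr : 1 ≤ r) (hs : 1 ≤ s) (hk : 1 ≤ k) (m : ℕ) :
    chainEta r s k m = ⨆ n ∈ {n : ℕ | HasSparseFamily r (s + 1) (k + 1) (m + 1) n}, (n : ℕ∞) := by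
  have : {n : ℕ | ∃ X : Fin n → IntervalChain k m, NoCommonStab r s X} =
      {n : ℕ | HasSparseFamily r (s + 1) (k + 1) (m + 1) n} := by
    ext n
    constructor
    · rintro ⟨X, hX⟩
      refine ⟨fun i => (X i).points, fun i => ⟨?_, (X i).card_points.ge⟩,
        (noCommonStab_iff hr hs X).1 hX⟩
      intro x hx
      obtain ⟨j, -, rfl⟩ := Finset.mem_image.1 hx
      exact Finset.mem_range.2 (Nat.lt_succ_of_le ((X i).point_le j))
    · rintro ⟨S, hS, hI⟩
      choose S' hS' hcard using fun i => Finset.exists_subset_card_eq (hS i).2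
      choose X hX using fun i =>
        IntervalChain.exists_points_eq hk (S' i) ((hS' i).trans (hS i).1) (hcard i)
      refine ⟨X, (noCommonStab_iff hr hs X).2 fun I hIr c hc => hI I hIr c (hc.anti ?_)⟩
      rintro _ ⟨i, hi, rfl⟩
      exact ⟨_, ⟨i, hi, rfl⟩, (congrArg (· ⊆ S i) (hX i)).mpr (hS' i)⟩
  rw [chainEta, this]

theorem formationF_succ_eq_chainEta {r s k : ℕ} (hr : 1 ≤ r) (hs : 1 ≤ s) (hk : 1 ≤ k) (m : ℕ) :
    formationF r (s + 1) (k + 1) (m + 1) = chainEta r s k m := by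
  rw [formationF_eq (by omega) (by omega), chainEta_eq hr hs hk]

theorem iSup_hasSparseFamily_ne_top {r s k m : ℕ} (hsk : s ≤ k) :
    (⨆ n ∈ {n : ℕ | HasSparseFamily r s k m n}, (n : ℕ∞)) ≠ ⊤ := by
  refine ne_top_of_le_ne_top (ENat.natCast_ne_top (2 ^ m * r)) (iSup₂_le fun n hn => ?_)
  exact_mod_cast HasSparseFamily.le hsk hn

theorem formationF_ne_top {r s k m : ℕ} (hk : 1 ≤ k) (hs : 1 ≤ s) (hsk : s ≤ k) :
    formationF r s k m ≠ ⊤ := by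
  rw [formationF_eq hk hs]
  exact iSup_hasSparseFamily_ne_top hsk

theorem le_toNat_formationF {r s k m n : ℕ} (hk : 1 ≤ k) (hs : 1 ≤ s) (hsk : s ≤ k)
    (h : HasSparseFamily r s k m n) : n ≤ (formationF r s k m).toNat := by
  have hle : (n : ℕ∞) ≤ formationF r s k m := by
    rw [formationF_eq hk hs]
    exact le_iSup₂_of_le (f := fun (n : ℕ) _ => (n : ℕ∞)) n h le_rfl
  simpa using ENat.toNat_le_toNat hle (formationF_ne_top hk hs hsk)

/-! ### Pairs of sets with four common intervals -/

/-- Both numbers `x, y` are smaller than both numbers `x', y'`. -/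
def Before (x y x' y' : ℕ) : Prop := x < x' ∧ x < y' ∧ y < x' ∧ y < y'

/-- There are four disjoint intervals which meet both `X` and `Y`. -/
def FourMeet (X Y : Finset ℕ) : Prop :=
  ∃ x₁ ∈ X, ∃ x₂ ∈ X, ∃ x₃ ∈ X, ∃ x₄ ∈ X, ∃ y₁ ∈ Y, ∃ y₂ ∈ Y, ∃ y₃ ∈ Y, ∃ y₄ ∈ Y,
    Before x₁ y₁ x₂ y₂ ∧ Before x₂ y₂ x₃ y₃ ∧ Before x₃ y₃ x₄ y₄

theorem Before.symm {x y x' y' : ℕ} (h : Before x y x' y') : Before y x y' x' :=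
  ⟨h.2.2.2, h.2.2.1, h.2.1, h.1⟩

theorem FourMeet.symm {X Y : Finset ℕ} : FourMeet X Y → FourMeet Y X := by
  rintro ⟨x₁, hx₁, x₂, hx₂, x₃, hx₃, x₄, hx₄, y₁, hy₁, y₂, hy₂, y₃, hy₃, y₄, hy₄, h₁, h₂, h₃⟩
  exact ⟨y₁, hy₁, y₂, hy₂, y₃, hy₃, y₄, hy₄, x₁, hx₁, x₂, hx₂, x₃, hx₃, x₄, hx₄,
    h₁.symm, h₂.symm, h₃.symm⟩

theorem Before.of_monotone {f : ℕ → ℕ} (hf : Monotone f) {x y x' y' : ℕ}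
    (h : Before (f x) (f y) (f x') (f y')) : Before x y x' y' :=
  ⟨hf.reflect_lt h.1, hf.reflect_lt h.2.1, hf.reflect_lt h.2.2.1, hf.reflect_lt h.2.2.2⟩

theorem FourMeet.of_image {f : ℕ → ℕ} (hf : Monotone f) {X Y : Finset ℕ}
    (h : FourMeet (X.image f) (Y.image f)) : FourMeet X Y := by
  simp only [FourMeet, Finset.exists_mem_image] at h
  obtain ⟨x₁, hx₁, x₂, hx₂, x₃, hx₃, x₄, hx₄, y₁, hy₁, y₂, hy₂, y₃, hy₃, y₄, hy₄, h₁, h₂, h₃⟩ := h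
  exact ⟨x₁, hx₁, x₂, hx₂, x₃, hx₃, x₄, hx₄, y₁, hy₁, y₂, hy₂, y₃, hy₃, y₄, hy₄,
    h₁.of_monotone hf, h₂.of_monotone hf, h₃.of_monotone hf⟩

theorem FourMeet.of_splitsInto {𝒜 : Set (Finset ℕ)} {X Y : Finset ℕ} (hX : X ∈ 𝒜) (hY : Y ∈ 𝒜)
    {c : ℕ} (h : SplitsInto 𝒜 4 c) : FourMeet X Y := by
  obtain ⟨c₃, -, ⟨c₂, -, ⟨c₁, -, ⟨c₀, -, -, h₁⟩, h₂⟩, h₃⟩, h₄⟩ := h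
  obtain ⟨x₁, hx₁, -, kx₁⟩ := h₁ X hX
  obtain ⟨x₂, hx₂, lx₂, kx₂⟩ := h₂ X hX
  obtain ⟨x₃, hx₃, lx₃, kx₃⟩ := h₃ X hX
  obtain ⟨x₄, hx₄, lx₄, -⟩ := h₄ X hX
  obtain ⟨y₁, hy₁, -, ky₁⟩ := h₁ Y hY
  obtain ⟨y₂, hy₂, ly₂, ky₂⟩ := h₂ Y hY
  obtain ⟨y₃, hy₃, ly₃, ky₃⟩ := h₃ Y hY
  obtain ⟨y₄, hy₄, ly₄, -⟩ := h₄ Y hY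
  refine ⟨x₁, hx₁, x₂, hx₂, x₃, hx₃, x₄, hx₄, y₁, hy₁, y₂, hy₂, y₃, hy₃, y₄, hy₄, ?_, ?_, ?_⟩ <;>
    refine ⟨?_, ?_, ?_, ?_⟩ <;> omega

/-! ### Systems of block sets -/

/-- A system of block sets: letters `a : Λ` with at least `k` occurrences each, of which no two
have four common intervals, and pairs `start i, start i + 1` of adjacent blocks. The first two
occurrences of a letter make up such a pair, and so do its last two occurrences. Every pair has one
slot for each `s : σ`, and `slot` puts the first two (`false`) and the last two (`true`)
occurrences of each letter bijectively into these slots. -/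
structure BlockSystem (k : ℕ) (ι σ Λ : Type) where
  /-- the first block of a pair -/
  start : ι → ℕ
  /-- the blocks in which a letter occurs -/
  occ : Λ → Finset ℕ
  /-- the slots of the first two and of the last two occurrences of a letter -/
  slot : Λ × Bool ≃ ι × σ
  start_injective : Function.Injective start
  start_ne : ∀ i j, start i ≠ start j + 1
  card_occ : ∀ a, k ≤ (occ a).card
  first_mem : ∀ a, start (slot (a, false)).1 ∈ occ a
  first_succ_mem : ∀ a, start (slot (a, false)).1 + 1 ∈ occ a
  first_le : ∀ a, ∀ p ∈ occ a, start (slot (a, false)).1 ≤ p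
  last_mem : ∀ a, start (slot (a, true)).1 ∈ occ a
  last_succ_mem : ∀ a, start (slot (a, true)).1 + 1 ∈ occ a
  le_last : ∀ a, ∀ p ∈ occ a, p ≤ start (slot (a, true)).1 + 1
  first_lt_last : ∀ a, start (slot (a, false)).1 + 1 < start (slot (a, true)).1
  not_fourMeet : ∀ a b, a ≠ b → ¬ FourMeet (occ a) (occ b)

/-- Renaming the slots. -/
def BlockSystem.congrSlots {k : ℕ} {ι σ σ' Λ : Type} (Z : BlockSystem k ι σ Λ) (e : σ ≃ σ') :
    BlockSystem k ι σ' Λ where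
  start := Z.start
  occ := Z.occ
  slot := Z.slot.trans (Equiv.prodCongr (Equiv.refl ι) e)
  start_injective := Z.start_injective
  start_ne := Z.start_ne
  card_occ := Z.card_occ
  first_mem := Z.first_mem
  first_succ_mem := Z.first_succ_mem
  first_le := Z.first_le
  last_mem := Z.last_mem
  last_succ_mem := Z.last_succ_mem
  le_last := Z.le_last
  first_lt_last := Z.first_lt_last
  not_fourMeet := Z.not_fourMeet

/-- The slots of the grid system: the letter `(i, j)` starts in the `i`-th pair of the first half
and ends in the `j`-th pair of the second half. -/
def gridSlot (f : ℕ) : (Fin f × Fin f) × Bool ≃ (Bool × Fin f) × Fin f where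
  toFun
    | ((i, j), false) => ((false, i), j)
    | ((i, j), true) => ((true, j), i)
  invFun
    | ((false, i), j) => ((i, j), false)
    | ((true, j), i) => ((i, j), true)
  left_inv := by rintro ⟨⟨i, j⟩, _ | _⟩ <;> rfl
  right_inv := by rintro ⟨⟨_ | _, i⟩, j⟩ <;> rfl

/-- The pairs of the grid system. -/
def gridStart (f : ℕ) : Bool × Fin f → ℕ
  | (false, i) => 2 * i
  | (true, j) => 2 * f + 2 * j

/-- The grid system: `f²` letters with four occurrences on `2 f` pairs of blocks. Two of its sets
have four common intervals only if they consist of the same two pairs. -/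
def gridSystem (f : ℕ) : BlockSystem 4 (Bool × Fin f) (Fin f) (Fin f × Fin f) where
  start := gridStart f
  occ a := {2 * a.1.val, 2 * a.1.val + 1, 2 * f + 2 * a.2.val, 2 * f + 2 * a.2.val + 1}
  slot := gridSlot f
  start_injective := by
    rintro ⟨_ | _, i⟩ ⟨_ | _, j⟩ h <;> simp only [gridStart] at h
    · exact congrArg _ (Fin.ext (by omega))
    · omega
    · omega
    · exact congrArg _ (Fin.ext (by omega))
  start_ne := by
    rintro ⟨_ | _, i⟩ ⟨_ | _, j⟩ <;> simp only [gridStart] <;> omega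
  card_occ := by
    rintro ⟨i, j⟩
    rw [Finset.card_insert_of_notMem, Finset.card_insert_of_notMem, Finset.card_insert_of_notMem,
      Finset.card_singleton]
    all_goals simp only [Finset.mem_insert, Finset.mem_singleton]; omega
  first_mem := by rintro ⟨i, j⟩; simp [gridSlot, gridStart]
  first_succ_mem := by rintro ⟨i, j⟩; simp [gridSlot, gridStart]
  first_le := by
    rintro ⟨i, j⟩ p hp
    simp only [Finset.mem_insert, Finset.mem_singleton] at hp
    simp only [gridSlot, gridStart, Equiv.coe_fn_mk]
    omega
  last_mem := by rintro ⟨i, j⟩; simp [gridSlot, gridStart]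
  last_succ_mem := by rintro ⟨i, j⟩; simp [gridSlot, gridStart]
  le_last := by
    rintro ⟨i, j⟩ p hp
    simp only [Finset.mem_insert, Finset.mem_singleton] at hp
    simp only [gridSlot, gridStart, Equiv.coe_fn_mk]
    omega
  first_lt_last := by
    rintro ⟨i, j⟩
    simp only [gridSlot, gridStart, Equiv.coe_fn_mk]
    omega
  not_fourMeet := by
    have key : ∀ (i j : Fin f) (x₁ x₂ x₃ x₄ : ℕ),
        x₁ ∈ ({2 * i.val, 2 * i.val + 1, 2 * f + 2 * j.val, 2 * f + 2 * j.val + 1} : Finset ℕ) →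
        x₂ ∈ ({2 * i.val, 2 * i.val + 1, 2 * f + 2 * j.val, 2 * f + 2 * j.val + 1} : Finset ℕ) →
        x₃ ∈ ({2 * i.val, 2 * i.val + 1, 2 * f + 2 * j.val, 2 * f + 2 * j.val + 1} : Finset ℕ) →
        x₄ ∈ ({2 * i.val, 2 * i.val + 1, 2 * f + 2 * j.val, 2 * f + 2 * j.val + 1} : Finset ℕ) →
        x₁ < x₂ → x₂ < x₃ → x₃ < x₄ → x₁ = 2 * i ∧ x₂ = 2 * i + 1 ∧ x₃ = 2 * f + 2 * j ∧
          x₄ = 2 * f + 2 * j + 1 := by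
      intro i j x₁ x₂ x₃ x₄ h₁ h₂ h₃ h₄
      simp only [Finset.mem_insert, Finset.mem_singleton] at h₁ h₂ h₃ h₄
      omega
    rintro ⟨i, j⟩ ⟨i', j'⟩ hne
    rintro ⟨x₁, hx₁, x₂, hx₂, x₃, hx₃, x₄, hx₄, y₁, hy₁, y₂, hy₂, y₃, hy₃, y₄, hy₄, h₁, h₂, h₃⟩
    obtain ⟨rfl, rfl, rfl, rfl⟩ := key i j _ _ _ _ hx₁ hx₂ hx₃ hx₄ h₁.1 h₂.1 h₃.1
    obtain ⟨rfl, rfl, rfl, rfl⟩ :=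
      key i' j' _ _ _ _ hy₁ hy₂ hy₃ hy₄ h₁.2.2.2 h₂.2.2.2 h₃.2.2.2
    obtain ⟨-, a₁, a₂, -⟩ := h₁
    obtain ⟨-, a₃, a₄, -⟩ := h₃
    exact hne (Prod.ext (Fin.ext (by dsimp only; omega)) (Fin.ext (by dsimp only; omega)))

/-- The system of `n` pairs without slots and without letters. -/
def emptySystem (k n : ℕ) : BlockSystem k (Fin n) (Fin 0) Empty where
  start i := 2 * i
  occ := Empty.elim
  slot := Equiv.equivOfIsEmpty _ _
  start_injective i j h := Fin.ext (by simpa using h)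
  start_ne i j := by omega
  card_occ := nofun
  first_mem := nofun
  first_succ_mem := nofun
  first_le := nofun
  last_mem := nofun
  last_succ_mem := nofun
  le_last := nofun
  first_lt_last := nofun
  not_fourMeet := nofun

/-! ### Insertion of systems into the pairs of a system -/

/-- Block `s` of the segment which replaces block `p` and the gap behind it. The block `p` itself
becomes the block `s = 0`. -/
def enc (K p s : ℕ) : ℕ := p * K + s

theorem enc_lt_enc {K p q s t : ℕ} (hs : s < K) (ht : t < K) :
    enc K p s < enc K q t ↔ p < q ∨ p = q ∧ s < t := by
  unfold enc
  rcases lt_trichotomy p q with h | rfl | h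
  · have := Nat.mul_le_mul_right K (Nat.succ_le_of_lt h)
    rw [Nat.succ_mul] at this
    omega
  · omega
  · have := Nat.mul_le_mul_right K (Nat.succ_le_of_lt h)
    rw [Nat.succ_mul] at this
    omega

theorem enc_inj {K p q s t : ℕ} (hs : s < K) (ht : t < K) :
    enc K p s = enc K q t ↔ p = q ∧ s = t := by
  have h1 := enc_lt_enc (p := p) (q := q) hs ht
  have h2 := enc_lt_enc (p := q) (q := p) ht hs
  constructor
  · intro h
    omega
  · rintro ⟨rfl, rfl⟩
    rfl

/-- The new occurrences of a letter with old occurrences `X`: its first occurrence `D` is replaced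
by the blocks `s + 1`, `s + 2` behind `D`, and its last occurrence `E + 1` by the blocks
`t + 1`, `t + 2` behind `E`. -/
def expand (K D s E t : ℕ) (X : Finset ℕ) : Finset ℕ :=
  {enc K D (s + 1), enc K D (s + 2), enc K E (t + 1), enc K E (t + 2)} ∪
    ((X.erase D).erase (E + 1)).image fun p => enc K p 0

theorem mem_expand {K D s E t : ℕ} {X : Finset ℕ} {q : ℕ} :
    q ∈ expand K D s E t X ↔ ∃ P S, q = enc K P S ∧
      (P = D ∧ S = s + 1 ∨ P = D ∧ S = s + 2 ∨ P = E ∧ S = t + 1 ∨ P = E ∧ S = t + 2 ∨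
        S = 0 ∧ P ∈ X ∧ P ≠ D ∧ P ≠ E + 1) := by
  simp only [expand, Finset.mem_union, Finset.mem_insert, Finset.mem_singleton, Finset.mem_image,
    Finset.mem_erase]
  constructor
  · rintro ((h | h | h | h) | ⟨p, ⟨h1, h2, h3⟩, rfl⟩)
    · exact ⟨_, _, h, Or.inl ⟨rfl, rfl⟩⟩
    · exact ⟨_, _, h, Or.inr (Or.inl ⟨rfl, rfl⟩)⟩
    · exact ⟨_, _, h, Or.inr (Or.inr (Or.inl ⟨rfl, rfl⟩))⟩
    · exact ⟨_, _, h, Or.inr (Or.inr (Or.inr (Or.inl ⟨rfl, rfl⟩)))⟩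
    · exact ⟨p, 0, rfl, Or.inr (Or.inr (Or.inr (Or.inr ⟨rfl, h3, h2, h1⟩)))⟩
  · rintro ⟨P, S, rfl, ⟨rfl, rfl⟩ | ⟨rfl, rfl⟩ | ⟨rfl, rfl⟩ | ⟨rfl, rfl⟩ | ⟨rfl, h1, h2, h3⟩⟩
    · exact Or.inl (Or.inl rfl)
    · exact Or.inl (Or.inr (Or.inl rfl))
    · exact Or.inl (Or.inr (Or.inr (Or.inl rfl)))
    · exact Or.inl (Or.inr (Or.inr (Or.inr rfl)))
    · exact Or.inr ⟨P, ⟨h3, h2, h1⟩, rfl⟩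

/-- Four increasing elements of an expanded set, in coordinates. The second one is either the second
element of the set or an old one, the third one is either the last but one or an old one. Here `p₂`
and `p₃` are old elements which take the place of the two. -/
theorem exists_coords_of_mem_expand {K D s E t : ℕ} {X : Finset ℕ} (hs : s + 2 < K) (ht : t + 2 < K)
    (hDE : D + 1 < E) (hD1 : D + 1 ∈ X) (hE : E ∈ X)
    (hmin : ∀ p ∈ X, D ≤ p) (hmax : ∀ p ∈ X, p ≤ E + 1) {q₁ q₂ q₃ q₄ : ℕ}
    (h₁ : q₁ ∈ expand K D s E t X) (h₂ : q₂ ∈ expand K D s E t X)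
    (h₃ : q₃ ∈ expand K D s E t X) (h₄ : q₄ ∈ expand K D s E t X)
    (h12 : q₁ < q₂) (h23 : q₂ < q₃) (h34 : q₃ < q₄) :
    ∃ P₁ S₁ P₂ S₂ P₃ S₃ P₄ S₄ p₂ p₃, q₁ = enc K P₁ S₁ ∧ q₂ = enc K P₂ S₂ ∧ q₃ = enc K P₃ S₃ ∧
      q₄ = enc K P₄ S₄ ∧ S₁ < K ∧ S₂ < K ∧ S₃ < K ∧ S₄ < K ∧ p₂ ∈ X ∧ p₃ ∈ X ∧ D < p₂ ∧ p₃ ≤ E ∧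
      (D < P₁ ∨ D = P₁ ∧ s + 1 ≤ S₁) ∧ (P₄ < E ∨ P₄ = E ∧ S₄ ≤ t + 2) ∧
      (P₂ = D ∧ S₂ = s + 2 ∧ p₂ = D + 1 ∧ P₁ = D ∧ S₁ = s + 1 ∨ S₂ = 0 ∧ p₂ = P₂) ∧
      (P₃ = E ∧ S₃ = t + 1 ∧ p₃ = E ∧ P₄ = E ∧ S₄ = t + 2 ∨ S₃ = 0 ∧ p₃ = P₃) := by
  rw [mem_expand] at h₁ h₂ h₃ h₄
  obtain ⟨P₁, S₁, rfl, k₁⟩ := h₁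
  obtain ⟨P₂, S₂, rfl, k₂⟩ := h₂
  obtain ⟨P₃, S₃, rfl, k₃⟩ := h₃
  obtain ⟨P₄, S₄, rfl, k₄⟩ := h₄
  have hS₁ : S₁ < K := by omega
  have hS₂ : S₂ < K := by omega
  have hS₃ : S₃ < K := by omega
  have hS₄ : S₄ < K := by omega
  rw [enc_lt_enc hS₁ hS₂] at h12
  rw [enc_lt_enc hS₂ hS₃] at h23
  rw [enc_lt_enc hS₃ hS₄] at h34
  have m₁ := fun h => hmin P₁ h
  have m₂ := fun h => hmin P₂ h
  have m₃ := fun h => hmax P₃ h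
  have m₄ := fun h => hmax P₄ h
  have low₁ : D < P₁ ∨ D = P₁ ∧ s + 1 ≤ S₁ := by
    rcases k₁ with h | h | h | h | ⟨_, h, _⟩
    · omega
    · omega
    · omega
    · omega
    · have := m₁ h; omega
  have high₄ : P₄ < E ∨ P₄ = E ∧ S₄ ≤ t + 2 := by
    rcases k₄ with h | h | h | h | ⟨_, h, _⟩
    · omega
    · omega
    · omega
    · omega
    · have := m₄ h; omega
  have mid₂ : ∃ p₂ ∈ X, D < p₂ ∧
      (P₂ = D ∧ S₂ = s + 2 ∧ p₂ = D + 1 ∧ P₁ = D ∧ S₁ = s + 1 ∨ S₂ = 0 ∧ p₂ = P₂) := by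
    rcases k₂ with h | h | h | h | ⟨h', h, h'', _⟩
    · omega
    · exact ⟨D + 1, hD1, by omega, Or.inl (by omega)⟩
    · omega
    · omega
    · have := m₂ h
      exact ⟨P₂, h, by omega, Or.inr ⟨h', rfl⟩⟩
  have mid₃ : ∃ p₃ ∈ X, p₃ ≤ E ∧
      (P₃ = E ∧ S₃ = t + 1 ∧ p₃ = E ∧ P₄ = E ∧ S₄ = t + 2 ∨ S₃ = 0 ∧ p₃ = P₃) := by
    rcases k₃ with h | h | h | h | ⟨h', h, h'', _⟩
    · omega
    · omega
    · exact ⟨E, hE, by omega, Or.inl (by omega)⟩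
    · omega
    · have := m₃ h
      exact ⟨P₃, h, by omega, Or.inr ⟨h', rfl⟩⟩
  obtain ⟨p₂, hp₂, hD₂, e₂⟩ := mid₂
  obtain ⟨p₃, hp₃, hE₃, e₃⟩ := mid₃
  exact ⟨P₁, S₁, P₂, S₂, P₃, S₃, P₄, S₄, p₂, p₃, rfl, rfl, rfl, rfl, hS₁, hS₂, hS₃, hS₄, hp₂, hp₃,
    hD₂, hE₃, low₁, high₄, e₂, e₃⟩

/-- If the first two of four elements of one set lie behind block `D`, then the second element
`(Q₂, T₂)` of the other set does not fit between `(D, s + 1)` and `(D + 1, 0)`. -/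
theorem add_one_lt_of_lex {D s D' s' Q₁ T₁ Q₂ T₂ q₂ V : ℕ} (hDD : ¬ (D = D' ∧ s = s'))
    (h₁ : D < Q₂ ∨ D = Q₂ ∧ s + 1 < T₂) (h₂ : Q₁ < D ∨ Q₁ = D ∧ T₁ < s + 2)
    (h₃ : Q₂ < V ∨ Q₂ = V ∧ T₂ < 0)
    (e : Q₂ = D' ∧ T₂ = s' + 2 ∧ q₂ = D' + 1 ∧ Q₁ = D' ∧ T₁ = s' + 1 ∨ T₂ = 0 ∧ q₂ = Q₂) :
    D + 1 < V := by
  omega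

theorem add_one_lt_of_lex' {D s D' s' E' t' Q₁ T₁ Q₂ T₂ q₂ : ℕ} (hDE' : D' + 1 < E')
    (hne : E' ≠ D + 1) (h₁ : D < Q₂ ∨ D = Q₂ ∧ s + 1 < T₂)
    (h₂ : Q₂ < E' ∨ Q₂ = E' ∧ T₂ < t' + 1)
    (e : Q₂ = D' ∧ T₂ = s' + 2 ∧ q₂ = D' + 1 ∧ Q₁ = D' ∧ T₁ = s' + 1 ∨ T₂ = 0 ∧ q₂ = Q₂) :
    D + 1 < E' := by
  omega

/-- If the last two of four elements of one set lie behind block `E`, then the third element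
`(Q₃, T₃)` of the other set does not fit between `(E, 0)` and `(E, t + 2)`. -/
theorem lt_of_lex {E t E' t' P Q₃ T₃ Q₄ T₄ q₃ : ℕ} (hEE : ¬ (E = E' ∧ t = t'))
    (h₁ : P < E ∨ P = E ∧ 0 < t + 1) (h₂ : P < Q₃ ∨ P = Q₃ ∧ 0 < T₃)
    (h₃ : E < Q₄ ∨ E = Q₄ ∧ t + 1 < T₄) (h₄ : Q₃ < E ∨ Q₃ = E ∧ T₃ < t + 2)
    (e : Q₃ = E' ∧ T₃ = t' + 1 ∧ q₃ = E' ∧ Q₄ = E' ∧ T₄ = t' + 2 ∨ T₃ = 0 ∧ q₃ = Q₃) :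
    P < E := by
  omega

/-- Expansion creates no pairs of sets with four common intervals: the first and the last of the
four intervals may be taken to contain the extreme elements of both sets, and the second and third
elements are mapped back to old elements in strictly increasing order. -/
theorem FourMeet.of_expand {K D s E t D' s' E' t' : ℕ} {X Y : Finset ℕ}
    (hs : s + 2 < K) (ht : t + 2 < K) (hs' : s' + 2 < K) (ht' : t' + 2 < K)
    (hDE : D + 1 < E) (hD : D ∈ X) (hD1 : D + 1 ∈ X) (hE : E ∈ X) (hE1 : E + 1 ∈ X)
    (hmin : ∀ p ∈ X, D ≤ p) (hmax : ∀ p ∈ X, p ≤ E + 1)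
    (hDE' : D' + 1 < E') (hD' : D' ∈ Y) (hD1' : D' + 1 ∈ Y) (hE' : E' ∈ Y) (hE1' : E' + 1 ∈ Y)
    (hmin' : ∀ p ∈ Y, D' ≤ p) (hmax' : ∀ p ∈ Y, p ≤ E' + 1)
    (hDD : ¬ (D = D' ∧ s = s')) (hEE : ¬ (E = E' ∧ t = t'))
    (hDE1 : E' ≠ D + 1) (hDE1' : E ≠ D' + 1)
    (h : FourMeet (expand K D s E t X) (expand K D' s' E' t' Y)) : FourMeet X Y := by
  obtain ⟨x₁, hx₁, x₂, hx₂, x₃, hx₃, x₄, hx₄, y₁, hy₁, y₂, hy₂, y₃, hy₃, y₄, hy₄,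
    ⟨a₁, a₂, a₃, a₄⟩, ⟨b₁, b₂, b₃, b₄⟩, ⟨c₁, c₂, c₃, c₄⟩⟩ := h
  obtain ⟨P₁, S₁, P₂, S₂, P₃, S₃, P₄, S₄, p₂, p₃, rfl, rfl, rfl, rfl, g₁, g₂, g₃, g₄, hp₂, hp₃,
    hDp, hEp, low, high, e₂, e₃⟩ :=
    exists_coords_of_mem_expand hs ht hDE hD1 hE hmin hmax hx₁ hx₂ hx₃ hx₄ a₁ b₁ c₁
  obtain ⟨Q₁, T₁, Q₂, T₂, Q₃, T₃, Q₄, T₄, q₂, q₃, rfl, rfl, rfl, rfl, k₁, k₂, k₃, k₄, hq₂, hq₃,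
    hDq, hEq, low', high', e₂', e₃'⟩ :=
    exists_coords_of_mem_expand hs' ht' hDE' hD1' hE' hmin' hmax' hy₁ hy₂ hy₃ hy₄ a₄ b₄ c₄
  rw [enc_lt_enc ‹_› ‹_›] at a₁ a₂ a₃ a₄ b₁ b₂ b₃ b₄ c₁ c₂ c₃ c₄
  clear hx₁ hx₂ hx₃ hx₄ hy₁ hy₂ hy₃ hy₄ hs ht hs' ht' g₁ g₂ g₃ g₄ k₁ k₂ k₃ k₄
  clear hmin hmax hmin' hmax'
  refine ⟨D, hD, p₂, hp₂, p₃, hp₃, E + 1, hE1, D', hD', q₂, hq₂, q₃, hq₃, E' + 1, hE1',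
    ⟨hDp, ?_, ?_, hDq⟩, ⟨?_, ?_, ?_, ?_⟩, ⟨by omega, ?_, ?_, by omega⟩⟩
  · clear a₁ a₃ a₄ b₁ b₂ b₃ b₄ c₁ c₂ c₃ c₄ e₂ e₃ e₃' high high'
    omega
  · clear a₁ a₂ a₄ b₁ b₂ b₃ b₄ c₁ c₂ c₃ c₄ e₃ e₃' high high'
    omega
  · rcases e₂ with ⟨rfl, rfl, rfl, rfl, rfl⟩ | ⟨rfl, rfl⟩ <;>
      rcases e₃ with ⟨rfl, rfl, rfl, rfl, rfl⟩ | ⟨rfl, rfl⟩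
    · exact hDE
    · exact add_one_lt_of_lex hDD a₂ a₃ b₃ e₂'
    · exact lt_of_lex hEE b₁ b₂ c₂ c₃ e₃'
    · omega
  · rcases e₂ with ⟨rfl, rfl, rfl, rfl, rfl⟩ | ⟨rfl, rfl⟩ <;>
      rcases e₃' with ⟨rfl, rfl, rfl, rfl, rfl⟩ | ⟨rfl, rfl⟩
    · exact add_one_lt_of_lex' hDE' hDE1 a₂ b₄ e₂'
    · exact add_one_lt_of_lex hDD a₂ a₃ b₄ e₂'
    · exact lt_of_lex (fun h => hEE ⟨h.1.symm, h.2.symm⟩) b₂ b₁ c₃ c₂ e₃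
    · omega
  · rcases e₂' with ⟨rfl, rfl, rfl, rfl, rfl⟩ | ⟨rfl, rfl⟩ <;>
      rcases e₃ with ⟨rfl, rfl, rfl, rfl, rfl⟩ | ⟨rfl, rfl⟩
    · exact add_one_lt_of_lex' hDE hDE1' a₃ b₁ e₂
    · exact add_one_lt_of_lex (fun h => hDD ⟨h.1.symm, h.2.symm⟩) a₃ a₂ b₁ e₂
    · exact lt_of_lex hEE b₃ b₄ c₂ c₃ e₃'
    · omega
  · rcases e₂' with ⟨rfl, rfl, rfl, rfl, rfl⟩ | ⟨rfl, rfl⟩ <;>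
      rcases e₃' with ⟨rfl, rfl, rfl, rfl, rfl⟩ | ⟨rfl, rfl⟩
    · exact hDE'
    · exact add_one_lt_of_lex (fun h => hDD ⟨h.1.symm, h.2.symm⟩) a₃ a₂ b₂ e₂
    · exact lt_of_lex (fun h => hEE ⟨h.1.symm, h.2.symm⟩) b₄ b₃ c₃ c₂ e₃
    · omega
  · clear a₁ a₂ a₃ a₄ b₁ b₂ b₃ b₄ c₁ c₃ c₄ e₂ e₂' e₃' low low'
    omega
  · clear a₁ a₂ a₃ a₄ b₁ b₂ b₃ b₄ c₁ c₂ c₄ e₂ e₂' e₃ low low'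
    omega

theorem card_expand {K D s E t : ℕ} {X : Finset ℕ} (hs : s + 2 < K) (ht : t + 2 < K)
    (hDE : D + 1 < E) : X.card + 2 ≤ (expand K D s E t X).card := by
  have hdisj : Disjoint
      ({enc K D (s + 1), enc K D (s + 2), enc K E (t + 1), enc K E (t + 2)} : Finset ℕ)
      (((X.erase D).erase (E + 1)).image fun p => enc K p 0) := by
    rw [Finset.disjoint_right]
    intro q hq
    obtain ⟨p, -, rfl⟩ := Finset.mem_image.1 hq
    simp only [Finset.mem_insert, Finset.mem_singleton, not_or]
    refine ⟨?_, ?_, ?_, ?_⟩ <;> rw [enc_inj (by omega) (by omega)] <;> omega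
  have hcard : ({enc K D (s + 1), enc K D (s + 2), enc K E (t + 1), enc K E (t + 2)} :
      Finset ℕ).card = 4 := by
    rw [Finset.card_insert_of_notMem, Finset.card_insert_of_notMem, Finset.card_insert_of_notMem,
      Finset.card_singleton]
    all_goals
      simp only [Finset.mem_insert, Finset.mem_singleton, not_or]
      try refine ⟨?_, ?_⟩
      all_goals try refine ⟨?_, ?_⟩
      all_goals rw [enc_inj (by omega) (by omega)]; omega
  rw [expand, Finset.card_union_of_disjoint hdisj, hcard, Finset.card_image_of_injective]
  · have h1 := Finset.pred_card_le_card_erase (s := X.erase D) (a := E + 1)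
    have h2 := Finset.pred_card_le_card_erase (s := X) (a := D)
    omega
  · intro p q h
    exact ((enc_inj (by omega) (by omega)).1 h).1

/-- An inserted set lies in one segment, which contains at most two elements of an expanded set. -/
theorem not_fourMeet_expand_image {K D s E t C : ℕ} {X Y : Finset ℕ} (hs : s + 2 < K)
    (ht : t + 2 < K) (hDE : D + 1 < E) (hD1 : D + 1 ∈ X) (hE : E ∈ X)
    (hmin : ∀ p ∈ X, D ≤ p) (hmax : ∀ p ∈ X, p ≤ E + 1) (hY : ∀ p ∈ Y, p + 1 < K) :
    ¬ FourMeet (expand K D s E t X) (Y.image fun p => enc K C (p + 1)) := by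
  rintro ⟨x₁, hx₁, x₂, hx₂, x₃, hx₃, x₄, hx₄, y₁, hy₁, y₂, -, y₃, -, y₄, hy₄,
    ⟨a₁, a₂, a₃, a₄⟩, ⟨b₁, b₂, b₃, b₄⟩, ⟨c₁, c₂, c₃, c₄⟩⟩
  obtain ⟨P₁, S₁, P₂, S₂, P₃, S₃, P₄, S₄, p₂, p₃, rfl, rfl, rfl, rfl, g₁, g₂, g₃, g₄, -, -,
    -, -, -, -, e₂, e₃⟩ :=
    exists_coords_of_mem_expand hs ht hDE hD1 hE hmin hmax hx₁ hx₂ hx₃ hx₄ a₁ b₁ c₁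
  obtain ⟨p, hp, rfl⟩ := Finset.mem_image.1 hy₁
  obtain ⟨q, hq, rfl⟩ := Finset.mem_image.1 hy₄
  have hp := hY p hp
  have hq := hY q hq
  rw [enc_lt_enc ‹_› ‹_›] at a₃ c₂ b₁
  omega

/-- The slots after insertion: the letters of the outer system fill up one new slot of every
inserted pair. -/
def insertSlot {ι ι' σ Λ Λ' : Type} (e : Λ × Bool ≃ ι × ι') (e' : Λ' × Bool ≃ ι' × σ) :
    (Λ ⊕ ι × Λ') × Bool ≃ (ι × ι') × Option σ where
  toFun
    | (Sum.inl a, b) => (e (a, b), none)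
    | (Sum.inr (i, x), b) => ((i, (e' (x, b)).1), some (e' (x, b)).2)
  invFun
    | (p, none) => (Sum.inl (e.symm p).1, (e.symm p).2)
    | ((i, l), some s) => (Sum.inr (i, (e'.symm (l, s)).1), (e'.symm (l, s)).2)
  left_inv := by rintro ⟨a | ⟨i, x⟩, b⟩ <;> simp
  right_inv := by rintro ⟨⟨i, l⟩, _ | s⟩ <;> simp

/-- Insert a copy of `Z'` into every pair of `Z`. The slots of this pair correspond to the pairs
of the copy: each letter of `Z` moves its first occurrence into the pair of the copy given by its
slot and gains an occurrence there, and the same happens to its last occurrence. -/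
def BlockSystem.insert {k : ℕ} {ι ι' σ Λ Λ' : Type} (Z : BlockSystem k ι ι' Λ)
    (Z' : BlockSystem (k + 2) ι' σ Λ') (K : ℕ) (hK : ∀ l, Z'.start l + 2 < K) :
    BlockSystem (k + 2) (ι × ι') (Option σ) (Λ ⊕ ι × Λ') where
  start p := enc K (Z.start p.1) (Z'.start p.2 + 1)
  occ
    | Sum.inl a => expand K (Z.start (Z.slot (a, false)).1) (Z'.start (Z.slot (a, false)).2)
        (Z.start (Z.slot (a, true)).1) (Z'.start (Z.slot (a, true)).2) (Z.occ a)
    | Sum.inr (i, x) => (Z'.occ x).image fun p => enc K (Z.start i) (p + 1)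
  slot := insertSlot Z.slot Z'.slot
  start_injective := by
    rintro ⟨i, l⟩ ⟨j, l'⟩ h
    have h1 := hK l
    have h2 := hK l'
    change enc K (Z.start i) (Z'.start l + 1) = enc K (Z.start j) (Z'.start l' + 1) at h
    obtain ⟨h3, h4⟩ := (enc_inj (by omega) (by omega)).1 h
    exact Prod.ext (Z.start_injective h3) (Z'.start_injective (Nat.succ_injective h4))
  start_ne := by
    rintro ⟨i, l⟩ ⟨j, l'⟩ h
    have h1 := hK l
    have h2 := hK l'
    change enc K (Z.start i) (Z'.start l + 1) = enc K (Z.start j) (Z'.start l' + 2) at h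
    obtain ⟨h3, h4⟩ := (enc_inj (by omega) (by omega)).1 h
    exact Z'.start_ne l l' (by omega)
  card_occ := by
    rintro (a | ⟨i, x⟩)
    · exact (Nat.add_le_add_right (Z.card_occ a) 2).trans
        (card_expand (hK _) (hK _) (Z.first_lt_last a))
    · dsimp only
      rw [Finset.card_image_of_injective]
      · exact Z'.card_occ x
      · intro p q h
        simpa [enc] using h
  first_mem := by
    rintro (a | ⟨i, x⟩)
    · exact mem_expand.2 ⟨_, _, rfl, by simp [insertSlot]⟩
    · exact Finset.mem_image.2 ⟨_, Z'.first_mem x, rfl⟩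
  first_succ_mem := by
    rintro (a | ⟨i, x⟩)
    · exact mem_expand.2 ⟨_, _, rfl, Or.inr (Or.inl ⟨rfl, rfl⟩)⟩
    · exact Finset.mem_image.2 ⟨_, Z'.first_succ_mem x, rfl⟩
  first_le := by
    rintro (a | ⟨i, x⟩) q hq
    · obtain ⟨P, S, rfl, h⟩ := mem_expand.1 hq
      have h1 := hK (Z.slot (a, false)).2
      have h2 := hK (Z.slot (a, true)).2
      have h3 := Z.first_lt_last a
      change enc K (Z.start (Z.slot (a, false)).1) (Z'.start (Z.slot (a, false)).2 + 1) ≤ _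
      rw [← not_lt, enc_lt_enc (by omega) (by omega)]
      rcases h with h | h | h | h | ⟨_, h, _⟩
      · omega
      · omega
      · omega
      · omega
      · have := Z.first_le a P h
        omega
    · obtain ⟨p, hp, rfl⟩ := Finset.mem_image.1 hq
      have := Z'.first_le x p hp
      simp only [insertSlot, enc, Equiv.coe_fn_mk]
      omega
  last_mem := by
    rintro (a | ⟨i, x⟩)
    · exact mem_expand.2 ⟨_, _, rfl, Or.inr (Or.inr (Or.inl ⟨rfl, rfl⟩))⟩
    · exact Finset.mem_image.2 ⟨_, Z'.last_mem x, rfl⟩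
  last_succ_mem := by
    rintro (a | ⟨i, x⟩)
    · exact mem_expand.2 ⟨_, _, rfl, Or.inr (Or.inr (Or.inr (Or.inl ⟨rfl, rfl⟩)))⟩
    · exact Finset.mem_image.2 ⟨_, Z'.last_succ_mem x, rfl⟩
  le_last := by
    rintro (a | ⟨i, x⟩) q hq
    · obtain ⟨P, S, rfl, h⟩ := mem_expand.1 hq
      have h1 := hK (Z.slot (a, false)).2
      have h2 := hK (Z.slot (a, true)).2
      have h3 := Z.first_lt_last a
      change _ ≤ enc K (Z.start (Z.slot (a, true)).1) (Z'.start (Z.slot (a, true)).2 + 2)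
      rw [← not_lt, enc_lt_enc (by omega) (by omega)]
      rcases h with h | h | h | h | ⟨_, h, _⟩
      · omega
      · omega
      · omega
      · omega
      · have := Z.le_last a P h
        omega
    · obtain ⟨p, hp, rfl⟩ := Finset.mem_image.1 hq
      have := Z'.le_last x p hp
      simp only [insertSlot, enc, Equiv.coe_fn_mk]
      omega
  first_lt_last := by
    rintro (a | ⟨i, x⟩)
    · have h1 := hK (Z.slot (a, false)).2
      have h2 := hK (Z.slot (a, true)).2
      have h3 := Z.first_lt_last a
      change enc K (Z.start (Z.slot (a, false)).1) (Z'.start (Z.slot (a, false)).2 + 2) <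
        enc K (Z.start (Z.slot (a, true)).1) (Z'.start (Z.slot (a, true)).2 + 1)
      rw [enc_lt_enc (by omega) (by omega)]
      omega
    · have := Z'.first_lt_last x
      simp only [insertSlot, enc, Equiv.coe_fn_mk]
      omega
  not_fourMeet := by
    have hY : ∀ x, ∀ p ∈ Z'.occ x, p + 1 < K := fun x p hp => by
      have h1 := Z'.le_last x p hp
      have h2 := hK (Z'.slot (x, true)).1
      omega
    have hmixed : ∀ a i x, ¬ FourMeet (expand K (Z.start (Z.slot (a, false)).1)
        (Z'.start (Z.slot (a, false)).2) (Z.start (Z.slot (a, true)).1)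
        (Z'.start (Z.slot (a, true)).2) (Z.occ a))
        ((Z'.occ x).image fun p => enc K (Z.start i) (p + 1)) := fun a i x =>
      not_fourMeet_expand_image (hK _) (hK _) (Z.first_lt_last a) (Z.first_succ_mem a)
        (Z.last_mem a) (Z.first_le a) (Z.le_last a) (hY x)
    rintro (a | ⟨i, x⟩) (b | ⟨j, y⟩) hne h
    · have hab : a ≠ b := fun h => hne (congrArg _ h)
      have hslot : ∀ c, ¬ (Z.start (Z.slot (a, c)).1 = Z.start (Z.slot (b, c)).1 ∧
          Z'.start (Z.slot (a, c)).2 = Z'.start (Z.slot (b, c)).2) := fun c ⟨h1, h2⟩ =>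
        hab (congrArg Prod.fst (Z.slot.injective
          (Prod.ext (Z.start_injective h1) (Z'.start_injective h2))))
      exact Z.not_fourMeet a b hab (FourMeet.of_expand (hK _) (hK _) (hK _) (hK _)
        (Z.first_lt_last a) (Z.first_mem a) (Z.first_succ_mem a) (Z.last_mem a)
        (Z.last_succ_mem a) (Z.first_le a) (Z.le_last a)
        (Z.first_lt_last b) (Z.first_mem b) (Z.first_succ_mem b) (Z.last_mem b)
        (Z.last_succ_mem b) (Z.first_le b) (Z.le_last b)
        (hslot false) (hslot true) (Z.start_ne _ _) (Z.start_ne _ _) h)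
    · exact hmixed a j y h
    · exact hmixed b i x h.symm
    · by_cases hij : i = j
      · subst hij
        refine Z'.not_fourMeet x y (fun h => hne (by rw [h])) (FourMeet.of_image ?_ h)
        intro p q hpq
        simp only [enc]
        omega
      · obtain ⟨x₁, hx₁, x₂, hx₂, -, -, -, -, y₁, hy₁, y₂, hy₂, -, -, -, -,
          ⟨-, a₂, a₃, -⟩, -, -⟩ := h
        obtain ⟨p₁, hp₁, rfl⟩ := Finset.mem_image.1 hx₁
        obtain ⟨p₂, hp₂, rfl⟩ := Finset.mem_image.1 hx₂
        obtain ⟨q₁, hq₁, rfl⟩ := Finset.mem_image.1 hy₁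
        obtain ⟨q₂, hq₂, rfl⟩ := Finset.mem_image.1 hy₂
        rw [enc_lt_enc (hY _ _ hp₁) (hY _ _ hq₂)] at a₂
        rw [enc_lt_enc (hY _ _ hq₁) (hY _ _ hp₂)] at a₃
        have := Z.start_injective.ne hij
        omega

/-! ### The number of pairs and of blocks -/

/-- There is a system with `S` pairs, each with `j` slots, on at most `M` blocks, in which every
letter occurs `2 e + 4` times. -/
def HasSystem (e j S M : ℕ) : Prop :=
  ∃ (ι Λ : Type) (_ : Fintype ι) (_ : Fintype Λ) (Z : BlockSystem (2 * e + 4) ι (Fin j) Λ)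
    (U : Finset ℕ), Fintype.card ι = S ∧ (∀ i, Z.start i ∈ U ∧ Z.start i + 1 ∈ U) ∧
      (∀ a, Z.occ a ⊆ U) ∧ U.card ≤ M

theorem hasSystem_grid (f : ℕ) : HasSystem 0 f (2 * f) (4 * f) := by
  refine ⟨Bool × Fin f, Fin f × Fin f, inferInstance, inferInstance, gridSystem f,
    Finset.range (4 * f), by simp, ?_, ?_, by simp⟩
  · rintro ⟨_ | _, i⟩ <;> simp only [gridSystem, gridStart, Finset.mem_range] <;> omega
  · rintro ⟨i, j⟩ p hp
    simp only [gridSystem, Finset.mem_insert, Finset.mem_singleton] at hp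
    rw [Finset.mem_range]
    omega

theorem hasSystem_empty (e : ℕ) : HasSystem e 0 4 8 := by
  refine ⟨Fin 4, Empty, inferInstance, inferInstance, emptySystem _ 4, Finset.range 8, by simp,
    fun i => ?_, nofun, by simp⟩
  simp only [emptySystem, Finset.mem_range]
  omega

theorem HasSystem.insert {e j f g M M' : ℕ} (h : HasSystem e f g M)
    (h' : HasSystem (e + 1) j f M') : HasSystem (e + 1) (j + 1) (f * g) (M + g * M') := by
  classical
  obtain ⟨ι, Λ, _, _, Z₀, U, hS, hU, hoU, hM⟩ := h
  obtain ⟨ι', Λ', _, _, Z', U', hS', hU', hoU', hM'⟩ := h'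
  let Z := Z₀.congrSlots (Fintype.equivFinOfCardEq hS').symm
  obtain ⟨K, hK⟩ : ∃ K, ∀ l, Z'.start l + 2 < K :=
    ⟨∑ l, Z'.start l + 3, fun l => by
      have := Finset.single_le_sum (f := Z'.start) (fun _ _ => Nat.zero_le _) (Finset.mem_univ l)
      omega⟩
  let W : Finset ℕ := (U.image fun p => enc K p 0) ∪
    ((Finset.univ : Finset ι) ×ˢ U').image fun x => enc K (Z₀.start x.1) (x.2 + 1)
  have hWin : ∀ i, ∀ p ∈ U', enc K (Z₀.start i) (p + 1) ∈ W := fun i p hp =>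
    Finset.mem_union_right _ (Finset.mem_image.2
      ⟨(i, p), Finset.mem_product.2 ⟨Finset.mem_univ _, hp⟩, rfl⟩)
  refine ⟨ι × ι', Λ ⊕ ι × Λ', inferInstance, inferInstance,
    (Z.insert Z' K hK).congrSlots (finSuccEquiv j).symm, W, ?_, ?_, ?_, ?_⟩
  · rw [Fintype.card_prod, hS, hS', mul_comm]
  · rintro ⟨i, l⟩
    exact ⟨hWin i _ (hU' l).1, hWin i _ (hU' l).2⟩
  · rintro (a | ⟨i, x⟩) q hq
    · obtain ⟨P, S, rfl, h⟩ := mem_expand.1 hq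
      rcases h with ⟨rfl, rfl⟩ | ⟨rfl, rfl⟩ | ⟨rfl, rfl⟩ | ⟨rfl, rfl⟩ | ⟨rfl, h, -⟩
      · exact hWin _ _ (hU' _).1
      · exact hWin _ _ (hU' _).2
      · exact hWin _ _ (hU' _).1
      · exact hWin _ _ (hU' _).2
      · exact Finset.mem_union_left _ (Finset.mem_image_of_mem _ (hoU a h))
    · obtain ⟨p, hp, rfl⟩ := Finset.mem_image.1 hq
      exact hWin i p (hoU' x hp)
  · refine (Finset.card_union_le _ _).trans (Nat.add_le_add ?_ ?_)
    · exact Finset.card_image_le.trans hM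
    · refine Finset.card_image_le.trans ?_
      rw [Finset.card_product, Finset.card_univ, hS]
      exact Nat.mul_le_mul_left g hM'

/-- The number of pairs of the iterated system in which every letter occurs `2 e + 4` times and
every pair has `j` slots. -/
def numPairs : ℕ → ℕ → ℕ
  | 0, f => 2 * f
  | _ + 1, 0 => 4
  | e + 1, j + 1 => numPairs (e + 1) j * numPairs e (numPairs (e + 1) j)
termination_by e j => (e, j)

theorem numPairs_zero (f : ℕ) : numPairs 0 f = 2 * f := by rw [numPairs]

theorem numPairs_succ_zero (e : ℕ) : numPairs (e + 1) 0 = 4 := by rw [numPairs]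

theorem numPairs_succ_succ (e j : ℕ) :
    numPairs (e + 1) (j + 1) = numPairs (e + 1) j * numPairs e (numPairs (e + 1) j) := by
  rw [numPairs]

theorem four_le_numPairs : ∀ e j, 4 ≤ j ∨ 1 ≤ e → 4 ≤ numPairs e j
  | 0, j, h => by rw [numPairs_zero]; omega
  | e + 1, 0, _ => (numPairs_succ_zero e).ge
  | e + 1, j + 1, _ => by
    have h1 := four_le_numPairs (e + 1) j (Or.inr (by omega))
    have h2 := four_le_numPairs e _ (Or.inl h1)
    rw [numPairs_succ_succ]
    nlinarith
termination_by e j => (e, j)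

theorem lt_numPairs (e : ℕ) : ∀ j, j < numPairs (e + 1) j
  | 0 => by rw [numPairs_succ_zero]; omega
  | j + 1 => by
    have h0 := lt_numPairs e j
    have h1 := four_le_numPairs (e + 1) j (Or.inr (by omega))
    have h2 := four_le_numPairs e _ (Or.inl h1)
    rw [numPairs_succ_succ]
    nlinarith

/-- The blocks are at most three times as many as the pairs: as the numbers of pairs grow
at least as fast as the powers of `4`, the blocks of the outer systems are negligible. -/
theorem exists_hasSystem : ∀ e j, ∃ M, M ≤ 3 * numPairs e j ∧ (1 ≤ e → M + 4 ≤ 3 * numPairs e j) ∧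
    HasSystem e j (numPairs e j) M
  | 0, j => ⟨4 * j, by rw [numPairs_zero]; omega, by omega, by
      rw [numPairs_zero]; exact hasSystem_grid j⟩
  | e + 1, 0 => ⟨8, by rw [numPairs_succ_zero]; omega, by rw [numPairs_succ_zero]; omega, by
      rw [numPairs_succ_zero]; exact hasSystem_empty _⟩
  | e + 1, j + 1 => by
    have h4 := four_le_numPairs (e + 1) j (Or.inr (by omega))
    obtain ⟨M', -, hM', h'⟩ := exists_hasSystem (e + 1) j
    obtain ⟨M, hM, -, h⟩ := exists_hasSystem e (numPairs (e + 1) j)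
    have hg := four_le_numPairs e _ (Or.inl h4)
    rw [numPairs_succ_succ]
    have hM' := hM' (by omega)
    generalize numPairs e (numPairs (e + 1) j) = g at *
    generalize numPairs (e + 1) j = f at *
    have : g * (M' + 4) ≤ g * (3 * f) := Nat.mul_le_mul_left g hM'
    have h5 : M + g * M' + 4 ≤ 3 * (f * g) := by nlinarith
    exact ⟨M + g * M', by omega, fun _ => h5, h.insert h'⟩
termination_by e j => (e, j)

theorem hasSparseFamily_of_pairwise {τ : Type} [Fintype τ] {k m : ℕ} (S : τ → Finset ℕ)
    (hS : ∀ a, S a ⊆ Finset.range m ∧ k ≤ (S a).card)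
    (h : ∀ a b, a ≠ b → ¬ FourMeet (S a) (S b)) : HasSparseFamily 2 4 k m (Fintype.card τ) := by
  let e := (Fintype.equivFin τ).symm
  refine ⟨fun i => S (e i), fun i => hS _, fun I hI c hc => ?_⟩
  obtain ⟨i, j, hij, rfl⟩ := Finset.card_eq_two.1 hI
  have hmem : ∀ l ∈ ({i, j} : Finset _),
      S (e l) ∈ (fun i => S (e i)) '' (({i, j} : Finset _) : Set (Fin (Fintype.card τ))) :=
    fun l hl => ⟨l, hl, rfl⟩
  exact h (e i) (e j) (e.injective.ne hij)
    (FourMeet.of_splitsInto (hmem i (by simp)) (hmem j (by simp)) hc)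

/-- Remove the unused blocks of a system and place `q` copies of it side by side. -/
theorem HasSystem.hasSparseFamily {e j S M : ℕ} (h : HasSystem e j S M) (q : ℕ) :
    ∃ n, 2 * n = q * (S * j) ∧ HasSparseFamily 2 4 (2 * e + 4) (q * M) n := by
  classical
  obtain ⟨ι, Λ, _, _, Z, U, hS, -, hoU, hM⟩ := h
  have hcard : Fintype.card Λ * 2 = S * j := by
    have := Fintype.card_congr Z.slot
    simpa [hS] using this
  have hlt : ∀ p ∈ U, countBelow U p < M := fun p hp => by
    refine lt_of_lt_of_le (Finset.card_lt_card ⟨Finset.filter_subset _ _, fun hsub => ?_⟩) hM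
    exact lt_irrefl p (Finset.mem_filter.1 (hsub hp)).2
  have hinj : Set.InjOn (countBelow U) U := by
    intro x hx y hy hxy
    rcases lt_trichotomy x y with h | h | h
    · exact absurd hxy ((countBelow_lt_iff h.le).2 ⟨x, hx, le_rfl, h⟩).ne
    · exact h
    · exact absurd hxy ((countBelow_lt_iff h.le).2 ⟨y, hy, le_rfl, h⟩).ne'
  let T : Fin q × Λ → Finset ℕ := fun x => (Z.occ x.2).image fun p => x.1 * M + countBelow U p
  have hT : ∀ x, ∀ y ∈ T x, x.1 * M ≤ y ∧ y < (x.1 + 1) * M := by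
    intro x y hy
    obtain ⟨p, hp, rfl⟩ := Finset.mem_image.1 hy
    have := hlt p (hoU _ hp)
    rw [Nat.succ_mul]
    omega
  refine ⟨Fintype.card (Fin q × Λ), ?_, hasSparseFamily_of_pairwise T (fun x => ⟨?_, ?_⟩) ?_⟩
  · rw [Fintype.card_prod, Fintype.card_fin, ← hcard]
    ring
  · intro y hy
    exact Finset.mem_range.2 ((hT x y hy).2.trans_le (Nat.mul_le_mul_right M x.1.2))
  · refine (Z.card_occ x.2).trans (Finset.card_image_of_injOn ?_).ge
    intro y hy z hz hyz
    exact hinj (hoU _ hy) (hoU _ hz) (Nat.add_left_cancel hyz)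
  · rintro ⟨c, a⟩ ⟨d, b⟩ hne hF
    by_cases hcd : c = d
    · subst hcd
      refine Z.not_fourMeet a b (fun h => hne (by rw [h])) (FourMeet.of_image ?_ hF)
      exact fun p p' hp => Nat.add_le_add_left (countBelow_mono U hp) _
    · obtain ⟨x₁, hx₁, x₂, hx₂, -, -, -, -, y₁, hy₁, y₂, hy₂, -, -, -, -,
        ⟨-, a₂, a₃, -⟩, -, -⟩ := hF
      have h₁ := hT _ _ hx₁
      have h₂ := hT _ _ hx₂
      have h₃ := hT _ _ hy₁
      have h₄ := hT _ _ hy₂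
      dsimp only at h₁ h₂ h₃ h₄
      rcases lt_or_gt_of_ne (fun h => hcd (Fin.ext h)) with h | h
      · have := Nat.mul_le_mul_right M (Nat.succ_le_of_lt h)
        rw [Nat.succ_eq_add_one] at this
        omega
      · have := Nat.mul_le_mul_right M (Nat.succ_le_of_lt h)
        rw [Nat.succ_eq_add_one] at this
        omega

theorem exists_hasSparseFamily {e j m : ℕ} (hm : 3 * numPairs e j ≤ m) (h0 : 1 ≤ e) :
    ∃ n, m * j ≤ 12 * n ∧ HasSparseFamily 2 4 (2 * e + 4) m n := by
  obtain ⟨M, hM, -, h⟩ := exists_hasSystem e j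
  set S := numPairs e j
  have hS : 4 ≤ S := four_le_numPairs e j (Or.inr h0)
  obtain ⟨n, hn, hf⟩ := h.hasSparseFamily (m / (3 * S))
  refine ⟨n, ?_, hf.mono le_rfl ?_⟩
  · have h1 := Nat.div_add_mod m (3 * S)
    have h2 := Nat.mod_lt m (show 0 < 3 * S by omega)
    have h3 : 1 ≤ m / (3 * S) := Nat.div_pos hm (by omega)
    generalize m / (3 * S) = q at *
    have h4 : 3 * S * 1 ≤ 3 * S * q := Nat.mul_le_mul_left _ h3
    have h5 : m ≤ 6 * (q * S) := by nlinarith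
    calc m * j ≤ 6 * (q * S) * j := Nat.mul_le_mul_right j h5
      _ = 6 * (q * (S * j)) := by ring
      _ = 12 * n := by rw [← hn]; ring
  · exact (Nat.mul_le_mul_left _ hM).trans (Nat.div_mul_le_self m (3 * S))

/-! ### Growth -/

theorem exists_maximal_numPairs {e b m : ℕ} (h : 3 * numPairs (e + 1) b ≤ m) :
    ∃ j, b ≤ j ∧ 3 * numPairs (e + 1) j ≤ m ∧ m < 3 * numPairs (e + 1) (j + 1) := by
  have hb : b ≤ m := by
    have := lt_numPairs e b
    omega
  refine ⟨Nat.findGreatest (fun j => 3 * numPairs (e + 1) j ≤ m) m,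
    Nat.le_findGreatest hb h, Nat.findGreatest_spec (P := fun j => 3 * numPairs (e + 1) j ≤ m) hb h,
    ?_⟩
  by_contra! hle
  have hlt := lt_numPairs e (Nat.findGreatest (fun j => 3 * numPairs (e + 1) j ≤ m) m + 1)
  exact Nat.findGreatest_is_greatest (P := fun j => 3 * numPairs (e + 1) j ≤ m)
    (Nat.lt_succ_self _) (by omega) hle

theorem two_mul_numPairs_one : ∀ j, 2 * numPairs 1 j = 8 ^ 2 ^ j
  | 0 => by rw [numPairs_succ_zero]; norm_num
  | j + 1 => by
    rw [numPairs_succ_succ, numPairs_zero, pow_succ, pow_mul, ← two_mul_numPairs_one j]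
    ring

theorem ackermannA_succ_succ (k n : ℕ) :
    ackermannA (k + 2) (n + 1) = ackermannA (k + 1) (ackermannA (k + 2) n) := by
  rw [ackermannA]

theorem ackermannA_succ_zero (k : ℕ) : ackermannA (k + 2) 0 = 1 := by
  rw [ackermannA]

theorem ackermannA_two : ∀ n, ackermannA 2 n = 2 ^ n
  | 0 => by rw [ackermannA_succ_zero, pow_zero]
  | n + 1 => by rw [ackermannA_succ_succ, ackermannA, ackermannA_two n, pow_succ, mul_comm]

theorem two_pow_le_ackermannA : ∀ k n, 2 ^ n ≤ ackermannA (k + 2) n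
  | 0, n => (ackermannA_two n).ge
  | k + 1, 0 => (ackermannA_succ_zero (k + 1)).ge
  | k + 1, n + 1 => by
    rw [ackermannA_succ_succ]
    refine le_trans ?_ (two_pow_le_ackermannA k _)
    have := (Nat.lt_two_pow_self (n := n)).trans_le (two_pow_le_ackermannA (k + 1) n)
    exact Nat.pow_le_pow_right (by norm_num) this

theorem lt_ackermannA (k n : ℕ) : n < ackermannA (k + 2) n :=
  (Nat.lt_two_pow_self (n := n)).trans_le (two_pow_le_ackermannA k n)

theorem two_pow_ackermannA_le (k n : ℕ) :
    2 ^ ackermannA (k + 3) n ≤ ackermannA (k + 3) (n + 1) := by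
  rw [ackermannA_succ_succ]
  exact two_pow_le_ackermannA k _

theorem ackermannA_strictMono : ∀ k, StrictMono (ackermannA (k + 2))
  | 0 => strictMono_nat_of_lt_succ fun n => by
    rw [ackermannA_two, ackermannA_two]
    exact Nat.pow_lt_pow_right (by norm_num) n.lt_succ_self
  | k + 1 => strictMono_nat_of_lt_succ fun n =>
    (Nat.lt_two_pow_self).trans_le (two_pow_ackermannA_le k n)

theorem numPairs_two_le : ∀ j, numPairs 2 j ≤ ackermannA 3 (3 * j + 2)
  | 0 => by
    rw [numPairs_succ_zero, ackermannA_succ_succ, ackermannA_succ_succ, ackermannA_succ_zero,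
      ackermannA_two, ackermannA_two]
    norm_num
  | j + 1 => by
    have ih := numPairs_two_le j
    have h4 := four_le_numPairs 2 j (Or.inr (by omega))
    rw [numPairs_succ_succ, show 3 * (j + 1) + 2 = 3 * j + 2 + 1 + 1 + 1 by ring,
      ackermannA_succ_succ, ackermannA_succ_succ, ackermannA_succ_succ, ackermannA_two,
      ackermannA_two, ackermannA_two]
    generalize ackermannA 3 (3 * j + 2) = T at *
    generalize numPairs 2 j = f at *
    have h1 := two_mul_numPairs_one f
    have h2 : f < 2 ^ f := Nat.lt_two_pow_self
    have h3 : f + 2 ≤ 2 ^ f := by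
      obtain ⟨g, rfl⟩ := Nat.exists_eq_add_of_le h4
      have : g < 2 ^ g := Nat.lt_two_pow_self
      rw [pow_add]
      omega
    calc f * numPairs 1 f ≤ 2 ^ f * 8 ^ 2 ^ f := Nat.mul_le_mul h2.le (by omega)
      _ = 2 ^ (f + 3 * 2 ^ f) := by
        rw [pow_add, pow_mul]
        norm_num
      _ ≤ 2 ^ 2 ^ 2 ^ T := by
        refine Nat.pow_le_pow_right (by norm_num) ?_
        calc f + 3 * 2 ^ f ≤ 2 ^ (f + 2) := by rw [pow_add]; omega
          _ ≤ 2 ^ 2 ^ T := Nat.pow_le_pow_right (by norm_num)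
            (h3.trans (Nat.pow_le_pow_right (by norm_num) ih))

/-- The number of pairs grows like the Ackermann hierarchy, up to a linear change of the argument
whose slope does not depend on `e`. -/
theorem exists_numPairs_le_ackermannA :
    ∀ e, ∃ C, ∀ j, numPairs (e + 2) j ≤ ackermannA (e + 3) (3 * j + C)
  | 0 => ⟨2, numPairs_two_le⟩
  | e + 1 => by
    obtain ⟨C, hC⟩ := exists_numPairs_le_ackermannA e
    refine ⟨C + 5, fun j => ?_⟩
    induction j with
    | zero =>
      have := lt_ackermannA (e + 2) (3 * 0 + (C + 5))
      rw [numPairs_succ_zero]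
      change 4 ≤ ackermannA (e + 2 + 2) _
      omega
    | succ j ih =>
      set T := ackermannA (e + 4) (3 * j + (C + 5)) with hT
      have hTC : 3 * j + (C + 5) < T := lt_ackermannA (e + 2) _
      have hmono := (ackermannA_strictMono (e + 1)).monotone
      have hf := hC (numPairs (e + 3) j)
      have hf' : ackermannA (e + 3) (3 * numPairs (e + 3) j + C) ≤ ackermannA (e + 3) (4 * T) :=
        hmono (by change numPairs (e + 3) j ≤ T at ih; omega)
      have hA := lt_ackermannA (e + 1) (4 * T)
      change 4 * T < ackermannA (e + 3) (4 * T) at hA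
      have hT4 : 4 * T + 1 ≤ ackermannA (e + 3) T := by
        refine le_trans ?_ (two_pow_le_ackermannA (e + 1) T)
        obtain ⟨g, hg⟩ := Nat.exists_eq_add_of_le (show 5 ≤ T by omega)
        have : g < 2 ^ g := Nat.lt_two_pow_self
        rw [hg, pow_add]
        omega
      change numPairs (e + 3) (j + 1) ≤ ackermannA (e + 4) _
      calc numPairs (e + 3) (j + 1)
          = numPairs (e + 3) j * numPairs (e + 2) (numPairs (e + 3) j) := numPairs_succ_succ _ _
        _ ≤ ackermannA (e + 3) (4 * T) * ackermannA (e + 3) (4 * T) :=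
          Nat.mul_le_mul (by change numPairs (e + 3) j ≤ T at ih; omega) (hf.trans hf')
        _ ≤ 2 ^ ackermannA (e + 3) (4 * T) := by
          generalize ackermannA (e + 3) (4 * T) = a at *
          obtain ⟨g, hg⟩ := Nat.exists_eq_add_of_le (show 4 ≤ a by omega)
          clear_value T
          clear hf hf' hT4 hA
          subst hg
          induction g with
          | zero => norm_num
          | succ g ih => rw [← add_assoc, pow_succ]; nlinarith
        _ ≤ ackermannA (e + 3) (4 * T + 1) := two_pow_ackermannA_le e _
        _ ≤ ackermannA (e + 3) (ackermannA (e + 3) T) := hmono hT4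
        _ = ackermannA (e + 4) (3 * j + (C + 5) + 1 + 1) := by
          rw [ackermannA_succ_succ, ackermannA_succ_succ]
        _ ≤ ackermannA (e + 4) (3 * (j + 1) + (C + 5)) :=
          (ackermannA_strictMono (e + 2)).monotone (by omega)

theorem exists_invAckermann_le (e : ℕ) : ∃ N, ∀ m, N ≤ m →
    ∃ j, 3 * numPairs (e + 2) j ≤ m ∧ invAckermann (e + 3) m ≤ 4 * j := by
  obtain ⟨C, hC⟩ := exists_numPairs_le_ackermannA e
  refine ⟨3 * numPairs (e + 2) (C + 5), fun m hm => ?_⟩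
  obtain ⟨j, hj, h1, h2⟩ := exists_maximal_numPairs hm
  refine ⟨j, h1, (Nat.sInf_le ?_ : _ ≤ 3 * (j + 1) + C + 1 + 1).trans (by omega)⟩
  have hdouble : ∀ n, 2 * ackermannA (e + 3) n ≤ ackermannA (e + 3) (n + 1) := fun n => by
    refine le_trans ?_ (two_pow_ackermannA_le e n)
    generalize ackermannA (e + 3) n = a
    cases a with
    | zero => simp
    | succ a =>
      have : a < 2 ^ a := Nat.lt_two_pow_self
      rw [pow_succ]
      omega
  have h3 := hdouble (3 * (j + 1) + C)
  have h4 := hdouble (3 * (j + 1) + C + 1)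
  have h5 := hC (j + 1)
  change m < 3 * numPairs (e + 2) (j + 1) at h2
  change m ≤ ackermannA (e + 3) (3 * (j + 1) + C + 1 + 1)
  omega

theorem exists_log_log_le {m : ℕ} (hm : 3 * numPairs 1 1 ≤ m) :
    ∃ j : ℕ, 3 * numPairs 1 j ≤ m ∧ Real.log (Real.log m) ≤ 4 * j := by
  obtain ⟨j, hj, h1, h2⟩ := exists_maximal_numPairs hm
  refine ⟨j, h1, ?_⟩
  have h12 : 12 ≤ 3 * numPairs 1 1 := by
    have := four_le_numPairs 1 1 (Or.inr le_rfl)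
    omega
  have hlt : (m : ℝ) ≤ 2 ^ 2 ^ (j + 3) := by
    have h3 : m ≤ 2 ^ 2 ^ (j + 3) := by
      have h4 := two_mul_numPairs_one (j + 1)
      change m < 3 * numPairs 1 (j + 1) at h2
      have h5 : (2 : ℕ) ^ 2 ^ (j + 3) = 8 ^ 2 ^ (j + 1) * 2 ^ 2 ^ (j + 1) := by
        rw [← mul_pow, show j + 3 = 2 + (j + 1) by ring, pow_add, pow_mul]
        norm_num
      have h6 : 8 ^ 2 ^ (j + 1) * 2 ≤ 8 ^ 2 ^ (j + 1) * 2 ^ 2 ^ (j + 1) :=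
        Nat.mul_le_mul_left _ (Nat.le_self_pow (by positivity) 2)
      omega
    exact_mod_cast h3
  have hm0 : (1 : ℝ) < m := by
    have : 1 < m := by omega
    exact_mod_cast this
  have hlog2 : Real.log 2 ≤ 1 := (Real.log_le_sub_one_of_pos (by norm_num)).trans (by norm_num)
  have hlog : Real.log m ≤ 2 ^ (j + 3) := by
    calc Real.log m ≤ Real.log (2 ^ 2 ^ (j + 3)) := Real.log_le_log (by linarith) hlt
      _ = 2 ^ (j + 3) * Real.log 2 := by rw [Real.log_pow]; push_cast; rfl
      _ ≤ 2 ^ (j + 3) * 1 := by gcongr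
      _ = 2 ^ (j + 3) := mul_one _
  have hj' : (1 : ℝ) ≤ j := by exact_mod_cast hj
  calc Real.log (Real.log m) ≤ Real.log (2 ^ (j + 3)) :=
        Real.log_le_log (Real.log_pos hm0) hlog
    _ = (j + 3) * Real.log 2 := by rw [Real.log_pow]; push_cast; rfl
    _ ≤ (j + 3) * 1 := by gcongr
    _ ≤ 4 * j := by linarith

/-- Sparse families yield lower bounds for both extremal functions. -/
theorem le_toNat_of_numPairs_le {e j m : ℕ} {x : ℝ} (he : 1 ≤ e) (hm : 3 * numPairs e j ≤ m)
    (hx : x ≤ 4 * j) {r : ℕ} (hr : 2 ≤ r) :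
    1 / 48 * (m * x) ≤ ((formationF r 4 (2 * e + 4) m).toNat : ℝ) ∧
      1 / 48 * (m * x) ≤ ((chainEta r 3 (2 * e + 3) m).toNat : ℝ) := by
  obtain ⟨n, hn, hf⟩ := exists_hasSparseFamily hm he
  have hn' : (m : ℝ) * j ≤ 12 * n := by exact_mod_cast hn
  have hxn : 1 / 48 * (m * x) ≤ (n : ℝ) := by
    have : (m : ℝ) * x ≤ m * (4 * j) := by gcongr
    linarith
  have hF : ∀ m', m ≤ m' → (n : ℝ) ≤ ((formationF r 4 (2 * e + 4) m').toNat : ℝ) := fun m' hm' => by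
    exact_mod_cast le_toNat_formationF (by omega) (by omega) (by omega) (hf.mono hr hm')
  refine ⟨hxn.trans (hF m le_rfl), ?_⟩
  rw [← formationF_succ_eq_chainEta (by omega) (by omega) (by omega)]
  exact hxn.trans (hF (m + 1) (Nat.le_succ m))

theorem formationF_eq_chainEta_and_ne_top {r k : ℕ} (hr : 1 ≤ r) (hk : 3 ≤ k) (m : ℕ) :
    formationF r 4 (k + 1) (m + 1) = chainEta r 3 k m ∧ formationF r 4 (k + 1) m ≠ ⊤ ∧
      chainEta r 3 k m ≠ ⊤ := by
  have h : ∀ m, formationF r 4 (k + 1) (m + 1) = chainEta r 3 k m :=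
    formationF_succ_eq_chainEta hr (by omega) (by omega)
  have hne : ∀ m, formationF r 4 (k + 1) m ≠ ⊤ := fun m =>
    formationF_ne_top (by omega) (by omega) (by omega)
  exact ⟨h m, hne m, h m ▸ hne (m + 1)⟩

end FormationChains

theorem mainTheorem7 :
    -- the identities between formations and interval chains (all values are finite)
    (∀ r : ℕ, 2 ≤ r → ∀ m : ℕ,
      FormationChains.formationF r 4 6 (m + 1) = FormationChains.chainEta r 3 5 m ∧
      FormationChains.formationF r 4 6 m ≠ ⊤ ∧
      FormationChains.chainEta r 3 5 m ≠ ⊤) ∧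
    (∀ r : ℕ, 2 ≤ r → ∀ d : ℕ, 3 ≤ d → ∀ m : ℕ,
      FormationChains.formationF r 4 (2 * d + 2) (m + 1) =
        FormationChains.chainEta r 3 (2 * d + 1) m ∧
      FormationChains.formationF r 4 (2 * d + 2) m ≠ ⊤ ∧
      FormationChains.chainEta r 3 (2 * d + 1) m ≠ ⊤) ∧
    -- the bound `Ω(m log log m)`
    (∃ c : ℝ, 0 < c ∧ ∃ N : ℕ, ∀ r : ℕ, 2 ≤ r → ∀ m : ℕ, N ≤ m →
      c * ((m : ℝ) * Real.log (Real.log (m : ℝ))) ≤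
        ((FormationChains.formationF r 4 6 m).toNat : ℝ) ∧
      c * ((m : ℝ) * Real.log (Real.log (m : ℝ))) ≤
        ((FormationChains.chainEta r 3 5 m).toNat : ℝ)) ∧
    -- the bound `Ω((1/d) m α_d(m))`, with a constant independent of `d` and `r`
    (∃ c : ℝ, 0 < c ∧ ∀ d : ℕ, 3 ≤ d → ∃ N : ℕ, ∀ r : ℕ, 2 ≤ r → ∀ m : ℕ, N ≤ m →
      c * (1 / (d : ℝ) * (m : ℝ) * (FormationChains.invAckermann d m : ℝ)) ≤
        ((FormationChains.formationF r 4 (2 * d + 2) m).toNat : ℝ) ∧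
      c * (1 / (d : ℝ) * (m : ℝ) * (FormationChains.invAckermann d m : ℝ)) ≤
        ((FormationChains.chainEta r 3 (2 * d + 1) m).toNat : ℝ)) := by
  refine ⟨fun r hr m => ?_, fun r hr d hd m => ?_, ⟨1 / 48, by norm_num, ?_⟩,
    ⟨1 / 48, by norm_num, fun d hd => ?_⟩⟩
  · exact FormationChains.formationF_eq_chainEta_and_ne_top (by omega) (by omega) m
  · exact FormationChains.formationF_eq_chainEta_and_ne_top (by omega) (by omega) m
  · refine ⟨3 * FormationChains.numPairs 1 1, fun r hr m hm => ?_⟩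
    obtain ⟨j, hj, hlog⟩ := FormationChains.exists_log_log_le hm
    exact FormationChains.le_toNat_of_numPairs_le le_rfl hj hlog hr
  · obtain ⟨e, rfl⟩ := Nat.exists_eq_add_of_le' hd
    obtain ⟨N, hN⟩ := FormationChains.exists_invAckermann_le e
    refine ⟨N, fun r hr m hm => ?_⟩
    obtain ⟨j, hj, hα⟩ := hN m hm
    have hx : (FormationChains.invAckermann (e + 3) m : ℝ) ≤ 4 * j := by exact_mod_cast hα
    obtain ⟨h1, h2⟩ := FormationChains.le_toNat_of_numPairs_le (by omega) hj hx hr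
    have hle : 1 / 48 * (1 / ((e + 3 : ℕ) : ℝ) * m * FormationChains.invAckermann (e + 3) m) ≤
        1 / 48 * (m * (FormationChains.invAckermann (e + 3) m : ℝ)) := by
      have hd1 : 1 / ((e + 3 : ℕ) : ℝ) ≤ 1 := by
        rw [div_le_one (by positivity)]
        push_cast
        linarith [(Nat.cast_nonneg e : (0 : ℝ) ≤ e)]
      have : 1 / ((e + 3 : ℕ) : ℝ) * m ≤ m := mul_le_of_le_one_left (Nat.cast_nonneg m) hd1
      gcongr
    exact ⟨hle.trans h1, hle.trans h2⟩
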